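/- **Proposition 1.1.** Let $n\ge 1$, let $M$ be a compact connected smooth $n$-dimensional manifold without boundary, let $X:M\to\mathbb{R}^{n+1}$ be a smooth immersion and let $N$ assign to each $p\in M$ a unit vector $N(p)\in\mathbb R^{n+1}$ normal to $X$ at $p$. Let $h(v,w)=\langle D^2X(v,w),N\rangle$ be the second fundamental form, and let $H=\sum_{i,j} g^{ij}h_{ij}$ be the mean curvature, i.e. the trace of $h$ with respect to the induced metric $g$ (so that the sphere of radius $r$ with its inner normal has $H=n/r$). Suppose that $X$ is a $\lambda$-hypersurface, that is, for some constant $\lambda\in\mathbb{R}$, $$\langle X,N\rangle+H=\lambda\quad\text{on } M.$$ If $$\Bigl(H-\frac{\lambda}{2}\Bigr)^2\le n+\frac{\lambda^2}{4}\quad\text{on } M,$$ then $\bigl(H-\frac{\lambda}{2}\bigr)^2= n+\frac{\lambda^2}{4}$ at every point of $M$, and $M$ with the induced metric is isometric to the round sphere $S^n(r)\subset\mathbb{R}^{n+1}$ for some radius $r>0$. -/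

import Mathlib

open scoped Manifold ContDiff

noncomputable section

namespace LambdaHypersurface

/-- The first fundamental form (induced metric) of a map `X` from an `n`-manifold into a Euclidean
space: the bilinear form `g_p(v, w) = ⟨dX_p v, dX_p w⟩` on the tangent space at `p`. -/
def firstFundamentalForm {n m : ℕ} {M : Type*} [TopologicalSpace M]
    [ChartedSpace (EuclideanSpace ℝ (Fin n)) M]
    (X : M → EuclideanSpace ℝ (Fin m)) (p : M) (v w : TangentSpace (𝓡 n) p) : ℝ :=
  inner ℝ (mvfderiv (𝓡 n) X p v) (mvfderiv (𝓡 n) X p w)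

/-- The second fundamental form of `X` at `p` with respect to the normal vector `ν`:
`h_p(v, w) = ⟨D²F(v, w), ν⟩`, where `F = X ∘ φ⁻¹` is the local parametrization given by the
preferred chart `φ` at `p`. (Mathlib identifies the tangent space at `p` with the model space
through this very chart. When `ν` is normal at `p`, the form does not depend on the chart; with
this sign, the unit sphere with its inner normal has `h = g`.) -/
def secondFundamentalForm {n m : ℕ} {M : Type*} [TopologicalSpace M]
    [ChartedSpace (EuclideanSpace ℝ (Fin n)) M]
    (X : M → EuclideanSpace ℝ (Fin m)) (ν : EuclideanSpace ℝ (Fin m)) (p : M)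
    (v w : TangentSpace (𝓡 n) p) : ℝ :=
  inner ℝ (fderiv ℝ (fderiv ℝ (X ∘ (extChartAt (𝓡 n) p).symm)) (extChartAt (𝓡 n) p p) v w) ν

/-- The `i`-th coordinate vector of the preferred chart at `p`. -/
def coordVector {n : ℕ} {M : Type*} [TopologicalSpace M]
    [ChartedSpace (EuclideanSpace ℝ (Fin n)) M] (p : M) (i : Fin n) : TangentSpace (𝓡 n) p :=
  (EuclideanSpace.single i (1 : ℝ) : EuclideanSpace ℝ (Fin n))

/-- The mean curvature at `p` with respect to the normal vector `ν`: the trace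
`H = ∑ g^{ij} h_{ij}` of the second fundamental form with respect to the induced metric (not
divided by `n`). -/
def meanCurvature {n m : ℕ} {M : Type*} [TopologicalSpace M]
    [ChartedSpace (EuclideanSpace ℝ (Fin n)) M]
    (X : M → EuclideanSpace ℝ (Fin m)) (ν : EuclideanSpace ℝ (Fin m)) (p : M) : ℝ :=
  Matrix.trace
    ((Matrix.of fun i j : Fin n => firstFundamentalForm X p (coordVector p i) (coordVector p j))⁻¹ *
      (Matrix.of fun i j : Fin n =>
        secondFundamentalForm X ν p (coordVector p i) (coordVector p j)))

/-- `X : M → ℝⁿ⁺¹`, with unit normal `N`, is a `λ`-hypersurface (with `l` for `λ`): `X` is a smooth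
immersion, each `N p` is a unit vector orthogonal to the tangent hyperplane `dX_p(T_p M)`, and
`⟨X, N⟩ + H = λ`, where `H` is the mean curvature with respect to `N`.
No continuity of `N` is asked for, so that an immersion of a non-orientable `M` with `λ = 0` is
covered too (changing the sign of `N p` changes that of `⟨X, N⟩ + H`, so for `λ ≠ 0` the equation
determines `N` and makes it smooth). -/
structure IsLambdaHypersurface {n : ℕ} {M : Type*} [TopologicalSpace M]
    [ChartedSpace (EuclideanSpace ℝ (Fin n)) M]
    (X N : M → EuclideanSpace ℝ (Fin (n + 1))) (l : ℝ) : Prop where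
  smooth : ContMDiff (𝓡 n) 𝓘(ℝ, EuclideanSpace ℝ (Fin (n + 1))) ∞ X
  immersion : ∀ p : M, Function.Injective (mvfderiv (𝓡 n) X p)
  norm_normal : ∀ p : M, ‖N p‖ = 1
  orthogonal : ∀ (p : M) (v : TangentSpace (𝓡 n) p), inner ℝ (mvfderiv (𝓡 n) X p v) (N p) = 0
  equation : ∀ p : M, inner ℝ (X p) (N p) + meanCurvature (n := n) X (N p) p = l

/-- `M`, with the metric induced by `X`, is isometric to the round sphere `Sⁿ(r)` of radius `r` in
`ℝⁿ⁺¹`. Here `Sⁿ(r)` is the standard smooth `n`-sphere with the metric induced by its embedding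
`y ↦ r y`, and an isometry is a diffeomorphism that preserves the metrics. -/
def IsIsometricToSphere {n : ℕ} {M : Type*} [TopologicalSpace M]
    [ChartedSpace (EuclideanSpace ℝ (Fin n)) M]
    (X : M → EuclideanSpace ℝ (Fin (n + 1))) (r : ℝ) : Prop :=
  ∃ Φ : M ≃ₘ^∞⟮𝓡 n, 𝓡 n⟯ (Metric.sphere (0 : EuclideanSpace ℝ (Fin (n + 1))) 1),
    ∀ (p : M) (v w : TangentSpace (𝓡 n) p),
      firstFundamentalForm
          (fun y : Metric.sphere (0 : EuclideanSpace ℝ (Fin (n + 1))) 1 =>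
            r • (y : EuclideanSpace ℝ (Fin (n + 1))))
          (Φ p) (mfderiv (𝓡 n) (𝓡 n) Φ p v) (mfderiv (𝓡 n) (𝓡 n) Φ p w) =
        firstFundamentalForm X p v w

end LambdaHypersurface

end

/-
The Laplacian of `‖X‖²` in the induced metric is
`2 (n + H ⟨X, N⟩) = 2 (n + λ² / 4 - (H - λ / 2)²)`, which the bound on `H` makes nonnegative. By the
strong maximum principle on the compact connected `M`, `‖X‖` is a constant `ρ`; the Laplacian of
`‖X‖²` then vanishes, which is the equality, and `X / ρ` is a local diffeomorphism onto the unit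
sphere, hence a covering. For `n ≥ 2` it has to be a diffeomorphism, and `M` is isometric to the
sphere of radius `ρ`. For `n = 1` it may wind `k` times around the circle; unwinding it turns `M`
into the circle of radius `k ρ`.
-/

namespace LambdaHypersurface

open Filter Function Metric Set Topology
open scoped InnerProductSpace Laplacian

section SecondOrder

variable {V W : Type*} [NormedAddCommGroup V] [NormedSpace ℝ V]
  [NormedAddCommGroup W] [NormedSpace ℝ W]

theorem deriv_deriv_nonpos_of_isLocalMax {f : ℝ → ℝ} {a : ℝ} (hmax : IsLocalMax f a)
    (hf : ContinuousAt f a) : deriv (deriv f) a ≤ 0 := by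
  by_contra! hpos
  have hmin : IsLocalMin f a := isLocalMin_of_deriv_deriv_pos hpos hmax.deriv_eq_zero hf
  have hconst : f =ᶠ[𝓝 a] fun _ => f a := by
    filter_upwards [hmax, hmin] with t h₁ h₂ using le_antisymm h₁ h₂
  have : deriv (deriv f) a = 0 := by simp [hconst.deriv.deriv_eq]
  exact hpos.ne' this

theorem deriv_deriv_comp_add_smul {f : V → W} {x : V} (hf : ContDiffAt ℝ 2 f x) (v : V) :
    deriv (deriv fun t : ℝ => f (x + t • v)) 0 = fderiv ℝ (fderiv ℝ f) x v v := by
  have hline (t : ℝ) : HasDerivAt (fun t : ℝ => x + t • v) v t := by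
    simpa using ((hasDerivAt_id t).smul_const v).const_add x
  have htendsto : Tendsto (fun t : ℝ => x + t • v) (𝓝 0) (𝓝 x) := by
    simpa using (hline 0).continuousAt.tendsto
  have hderiv : deriv (fun t : ℝ => f (x + t • v)) =ᶠ[𝓝 0] fun t => fderiv ℝ f (x + t • v) v := by
    filter_upwards [htendsto.eventually (hf.eventually (by simp))] with t ht
    exact ((ht.differentiableAt (by simp)).hasFDerivAt.comp_hasDerivAt t (hline t)).deriv
  have hD : HasFDerivAt (fderiv ℝ f) (fderiv ℝ (fderiv ℝ f) x) (x + (0 : ℝ) • v) := by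
    simpa using ((hf.fderiv_right (m := 1) (by norm_num)).differentiableAt (by simp)).hasFDerivAt
  have hDline : HasDerivAt (fun t : ℝ => fderiv ℝ f (x + t • v)) (fderiv ℝ (fderiv ℝ f) x v) 0 :=
    hD.comp_hasDerivAt (0 : ℝ) (hline 0)
  rw [hderiv.deriv_eq]
  exact ((ContinuousLinearMap.apply ℝ W v).hasFDerivAt.comp_hasDerivAt (0 : ℝ) hDline).deriv

theorem fderiv_fderiv_nonpos_of_isLocalMax {f : V → ℝ} {x : V} (hf : ContDiffAt ℝ 2 f x)
    (hmax : IsLocalMax f x) (v : V) : fderiv ℝ (fderiv ℝ f) x v v ≤ 0 := by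
  have hcont : ContinuousAt (fun t : ℝ => x + t • v) 0 := by fun_prop
  rw [← deriv_deriv_comp_add_smul hf v]
  refine deriv_deriv_nonpos_of_isLocalMax ?_
    (ContinuousAt.comp (by simpa using hf.continuousAt) hcont)
  have hmax' : ∀ᶠ y in 𝓝 (x + (0 : ℝ) • v), f y ≤ f x := by simpa using! hmax
  filter_upwards [hcont.tendsto.eventually hmax'] with t ht
  simpa using ht

theorem fderiv_fderiv_comp_apply {Z : Type*} [NormedAddCommGroup Z] [NormedSpace ℝ Z]
    {φ : W → Z} {F : V → W} {x : V} (hφ : ContDiffAt ℝ 2 φ (F x)) (hF : ContDiffAt ℝ 2 F x)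
    (v w : V) :
    fderiv ℝ (fderiv ℝ (φ ∘ F)) x v w =
      fderiv ℝ (fderiv ℝ φ) (F x) (fderiv ℝ F x v) (fderiv ℝ F x w) +
        fderiv ℝ φ (F x) (fderiv ℝ (fderiv ℝ F) x v w) := by
  have hfst : fderiv ℝ (φ ∘ F) =ᶠ[𝓝 x] fun y => (fderiv ℝ φ (F y)).comp (fderiv ℝ F y) := by
    filter_upwards [hF.continuousAt.tendsto.eventually (hφ.eventually (by simp)),
      hF.eventually (by simp)] with y h₁ h₂
    exact fderiv_comp y (h₁.differentiableAt (by simp)) (h₂.differentiableAt (by simp))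
  have hDφ : HasFDerivAt (fderiv ℝ φ) (fderiv ℝ (fderiv ℝ φ) (F x)) (F x) :=
    ((hφ.fderiv_right (m := 1) (by norm_num)).differentiableAt (by simp)).hasFDerivAt
  have hDF : HasFDerivAt (fderiv ℝ F) (fderiv ℝ (fderiv ℝ F) x) x :=
    ((hF.fderiv_right (m := 1) (by norm_num)).differentiableAt (by simp)).hasFDerivAt
  have hF' : HasFDerivAt F (fderiv ℝ F x) x := (hF.differentiableAt (by simp)).hasFDerivAt
  have hsnd := (HasFDerivAt.comp (g := fderiv ℝ φ) x hDφ hF').clm_comp hDF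
  rw [hfst.fderiv_eq]
  refine (congr_arg (fun D => D v w) hsnd.fderiv).trans ?_
  simp [add_comm]

end SecondOrder

section AdaptedFrame

theorem trace_toMatrix_inv_mul_toMatrix {R V ι : Type*} [CommRing R] [AddCommGroup V] [Module R V]
    [Fintype ι] [DecidableEq ι] (b c : Module.Basis ι R V) {G : LinearMap.BilinForm R V}
    (hG : LinearMap.BilinForm.toMatrix c G = 1) (A : LinearMap.BilinForm R V) :
    ((LinearMap.BilinForm.toMatrix b G)⁻¹ * LinearMap.BilinForm.toMatrix b A).trace =
      (LinearMap.BilinForm.toMatrix c A).trace := by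
  set P := b.toMatrix c
  have hP : P.transpose * LinearMap.BilinForm.toMatrix b G * P = 1 :=
    (LinearMap.BilinForm.toMatrix_mul_basis_toMatrix b c G).trans hG
  have hinv : (LinearMap.BilinForm.toMatrix b G)⁻¹ = P * P.transpose := by
    refine Matrix.inv_eq_left_inv ?_
    rw [Matrix.mul_assoc]
    exact mul_eq_one_comm.1 hP
  rw [hinv, Matrix.mul_assoc, Matrix.trace_mul_comm,
    LinearMap.BilinForm.toMatrix_mul_basis_toMatrix b c A]

variable {n : ℕ} {V E : Type*} [AddCommGroup V] [Module ℝ V]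
  [NormedAddCommGroup E] [InnerProductSpace ℝ E]

theorem exists_basis_orthonormalBasis_adapted [FiniteDimensional ℝ V]
    (hV : Module.finrank ℝ V = n) (hE : Module.finrank ℝ E = n + 1) {L : V →ₗ[ℝ] E}
    (hL : Injective L) {ν : E} (hν : ‖ν‖ = 1) (hLν : ∀ v, ⟪L v, ν⟫_ℝ = 0) :
    ∃ (w : Module.Basis (Fin n) ℝ V) (e : OrthonormalBasis (Fin (n + 1)) ℝ E),
      e 0 = ν ∧ ∀ i, e i.succ = L (w i) := by
  let ι := LinearEquiv.ofInjective L hL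
  have hrange : Module.finrank ℝ L.range = n := (LinearEquiv.finrank_eq ι).symm.trans hV
  let b : OrthonormalBasis (Fin n) ℝ L.range :=
    (stdOrthonormalBasis ℝ L.range).reindex (finCongr hrange)
  let w := b.toBasis.map ι.symm
  have hw (i : Fin n) : L (w i) = b i := by
    simp [w, ι]
  have horth : Orthonormal ℝ (Fin.cons ν fun i => L (w i) : Fin (n + 1) → E) := by
    rw [orthonormal_iff_ite]
    intro i j
    induction i using Fin.cases <;> induction j using Fin.cases
    · simp [hν]
    · simp [real_inner_comm _ ν, hLν, (Fin.succ_ne_zero _).symm]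
    · simp [hLν]
    · simpa [hw] using orthonormal_iff_ite.1 b.orthonormal _ _
  have : FiniteDimensional ℝ E := FiniteDimensional.of_finrank_pos (by omega)
  let e := basisOfOrthonormalOfCardEqFinrank horth (by simp [hE])
  refine ⟨w, e.toOrthonormalBasis (by simpa [e] using horth), by simp [e], by simp [e]⟩

end AdaptedFrame

section Radial

variable {E : Type*} [NormedAddCommGroup E] [InnerProductSpace ℝ E]

theorem contDiff_norm_sub_sq {k : WithTop ℕ∞} (c : E) : ContDiff ℝ k fun y : E => ‖y - c‖ ^ 2 :=
  (contDiff_id.sub contDiff_const).norm_sq ℝ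

theorem fderiv_norm_sub_sq (c x : E) :
    fderiv ℝ (fun y => ‖y - c‖ ^ 2) x = (2 : ℝ) • innerSL ℝ (x - c) := by
  have h := ((hasFDerivAt_id x).sub_const c).norm_sq.fderiv
  rw [ContinuousLinearMap.comp_id, ← ofNat_smul_eq_nsmul ℝ] at h
  exact h

theorem fderiv_fderiv_norm_sub_sq (c x v w : E) :
    fderiv ℝ (fderiv ℝ fun y => ‖y - c‖ ^ 2) x v w = 2 * ⟪v, w⟫_ℝ := by
  have hfst : (fderiv ℝ fun y => ‖y - c‖ ^ 2) = fun y => (2 : ℝ) • innerSL ℝ (y - c) :=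
    funext (fderiv_norm_sub_sq c)
  have hsnd := (((innerSL ℝ : E →L[ℝ] E →L[ℝ] ℝ).hasFDerivAt.comp x
    ((hasFDerivAt_id x).sub_const c)).const_smul (2 : ℝ)).fderiv
  rw [hfst]
  exact congr_arg (fun D => D v w) hsnd

theorem fderiv_fderiv_eq_mul_deriv_deriv {g : ℝ → ℝ} {s : ℝ} (hg : ContDiffAt ℝ 2 g s) (a b : ℝ) :
    fderiv ℝ (fderiv ℝ g) s a b = a * b * deriv (deriv g) s := by
  have hd : DifferentiableAt ℝ (fderiv ℝ g) s :=
    (hg.fderiv_right (m := 1) (by norm_num)).differentiableAt (by simp)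
  have hderiv : deriv (deriv g) s = fderiv ℝ (fderiv ℝ g) s 1 1 :=
    (hd.hasFDerivAt.hasDerivAt.clm_apply (hasDerivAt_const s (1 : ℝ))).deriv.trans (by simp)
  calc fderiv ℝ (fderiv ℝ g) s a b = fderiv ℝ (fderiv ℝ g) s (a • 1) (b • 1) := by
        simp only [smul_eq_mul, mul_one]
    _ = a * b * deriv (deriv g) s := by
        rw [map_smul, map_smul, smul_apply, hderiv, smul_eq_mul, smul_eq_mul]; ring

variable {g : ℝ → ℝ} {c x : E}

theorem fderiv_radial_apply (hg : ContDiffAt ℝ 2 g (‖x - c‖ ^ 2)) (v : E) :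
    fderiv ℝ (fun y => g (‖y - c‖ ^ 2)) x v = 2 * deriv g (‖x - c‖ ^ 2) * ⟪x - c, v⟫_ℝ := by
  have hq := ((contDiff_norm_sub_sq (k := 1) c).differentiable (by simp)).differentiableAt (x := x)
  have hchain := fderiv_comp x (hg.differentiableAt (by simp)) hq
  rw [fderiv_norm_sub_sq] at hchain
  refine (congr_arg (fun D => D v) hchain).trans ?_
  simp only [ContinuousLinearMap.comp_apply, smul_apply, innerSL_apply_apply, smul_eq_mul,
    fderiv_eq_smul_deriv]
  ring

theorem fderiv_fderiv_radial_apply (hg : ContDiffAt ℝ 2 g (‖x - c‖ ^ 2)) (v w : E) :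
    fderiv ℝ (fderiv ℝ fun y => g (‖y - c‖ ^ 2)) x v w =
      4 * deriv (deriv g) (‖x - c‖ ^ 2) * (⟪x - c, v⟫_ℝ * ⟪x - c, w⟫_ℝ) +
        2 * deriv g (‖x - c‖ ^ 2) * ⟪v, w⟫_ℝ := by
  have hchain := fderiv_fderiv_comp_apply (F := fun y => ‖y - c‖ ^ 2) (x := x) hg
    (contDiff_norm_sub_sq c).contDiffAt v w
  rw [fderiv_fderiv_norm_sub_sq, fderiv_norm_sub_sq, fderiv_fderiv_eq_mul_deriv_deriv hg] at hchain
  refine hchain.trans ?_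
  simp only [smul_apply, innerSL_apply_apply, smul_eq_mul, fderiv_eq_smul_deriv]
  ring

end Radial

section HypersurfaceLaplacian

variable {E : Type*} [NormedAddCommGroup E] [InnerProductSpace ℝ E] [FiniteDimensional ℝ E]

/-- The Laplace–Beltrami operator of a hypersurface of `E`, applied to the restriction of the
ambient function `φ`, at a point `x` where the hypersurface has unit normal `ν` and mean curvature
`H`. By Gauss's formula it is the trace of `D²φ` over `νᗮ` plus the contribution `H ∂φ/∂ν` of the
mean curvature vector, and this is taken as the definition. -/
noncomputable def hypersurfaceLaplacian (φ : E → ℝ) (x ν : E) (H : ℝ) : ℝ :=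
  Δ φ x - fderiv ℝ (fderiv ℝ φ) x ν ν + H * fderiv ℝ φ x ν

theorem laplacian_eq_sum_fderiv_fderiv {ι : Type*} [Fintype ι] (φ : E → ℝ) (x : E)
    (e : OrthonormalBasis ι ℝ E) : Δ φ x = ∑ i, fderiv ℝ (fderiv ℝ φ) x (e i) (e i) := by
  simp [InnerProductSpace.laplacian_eq_iteratedFDeriv_orthonormalBasis φ e,
    iteratedFDeriv_two_apply]

theorem hypersurfaceLaplacian_eq_sum {n : ℕ} (φ : E → ℝ) (x : E) (H : ℝ)
    (e : OrthonormalBasis (Fin (n + 1)) ℝ E) :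
    hypersurfaceLaplacian φ x (e 0) H =
      ∑ i : Fin n, fderiv ℝ (fderiv ℝ φ) x (e i.succ) (e i.succ) + H * fderiv ℝ φ x (e 0) := by
  rw [hypersurfaceLaplacian, laplacian_eq_sum_fderiv_fderiv φ x e, Fin.sum_univ_succ]
  ring

theorem hypersurfaceLaplacian_add {φ ψ : E → ℝ} {x : E} (hφ : ContDiffAt ℝ 2 φ x)
    (hψ : ContDiffAt ℝ 2 ψ x) (ν : E) (H : ℝ) :
    hypersurfaceLaplacian (φ + ψ) x ν H =
      hypersurfaceLaplacian φ x ν H + hypersurfaceLaplacian ψ x ν H := by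
  have hfst : fderiv ℝ (φ + ψ) =ᶠ[𝓝 x] fderiv ℝ φ + fderiv ℝ ψ := by
    filter_upwards [hφ.eventually (by simp), hψ.eventually (by simp)] with y h₁ h₂
    exact fderiv_add (h₁.differentiableAt (by simp)) (h₂.differentiableAt (by simp))
  have hsnd : fderiv ℝ (fderiv ℝ (φ + ψ)) x =
      fderiv ℝ (fderiv ℝ φ) x + fderiv ℝ (fderiv ℝ ψ) x := by
    rw [hfst.fderiv_eq]
    exact fderiv_add ((hφ.fderiv_right (m := 1) (by norm_num)).differentiableAt (by simp))
      ((hψ.fderiv_right (m := 1) (by norm_num)).differentiableAt (by simp))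
  simp only [hypersurfaceLaplacian, hφ.laplacian_add hψ, hsnd, hfst.self_of_nhds, Pi.add_apply,
    add_apply]
  ring

theorem hypersurfaceLaplacian_const_smul {φ : E → ℝ} {x : E} (hφ : ContDiffAt ℝ 2 φ x) (a : ℝ)
    (ν : E) (H : ℝ) :
    hypersurfaceLaplacian (a • φ) x ν H = a * hypersurfaceLaplacian φ x ν H := by
  have hsnd : fderiv ℝ (a • fderiv ℝ φ) x = a • fderiv ℝ (fderiv ℝ φ) x :=
    ((hφ.fderiv_right (m := 1) le_rfl).differentiableAt one_ne_zero).hasFDerivAt.const_smul a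
      |>.fderiv
  rw [hypersurfaceLaplacian, hypersurfaceLaplacian, InnerProductSpace.laplacian_smul a hφ,
    fderiv_const_smul_field a, hsnd]
  simp only [smul_apply, Pi.smul_apply, smul_eq_mul]
  ring

theorem hypersurfaceLaplacian_radial {n : ℕ} (hE : Module.finrank ℝ E = n + 1) {g : ℝ → ℝ}
    {c x : E} (hg : ContDiffAt ℝ 2 g (‖x - c‖ ^ 2)) {ν : E} (hν : ‖ν‖ = 1) (H : ℝ) :
    hypersurfaceLaplacian (fun y => g (‖y - c‖ ^ 2)) x ν H =
      4 * deriv (deriv g) (‖x - c‖ ^ 2) * (‖x - c‖ ^ 2 - ⟪x - c, ν⟫_ℝ ^ 2) +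
        2 * deriv g (‖x - c‖ ^ 2) * (n + H * ⟪x - c, ν⟫_ℝ) := by
  have hΔ : Δ (fun y => g (‖y - c‖ ^ 2)) x =
      4 * deriv (deriv g) (‖x - c‖ ^ 2) * ‖x - c‖ ^ 2 + 2 * deriv g (‖x - c‖ ^ 2) * (n + 1) := by
    rw [laplacian_eq_sum_fderiv_fderiv _ x (stdOrthonormalBasis ℝ E)]
    simp only [fderiv_fderiv_radial_apply hg, Finset.sum_add_distrib, ← Finset.mul_sum, ← sq,
      (stdOrthonormalBasis ℝ E).sum_sq_inner_left, real_inner_self_eq_norm_sq,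
      OrthonormalBasis.norm_eq_one]
    simp [hE]
  rw [hypersurfaceLaplacian, hΔ, fderiv_fderiv_radial_apply hg, fderiv_radial_apply hg,
    real_inner_self_eq_norm_sq, hν]
  ring

theorem hypersurfaceLaplacian_nonpos_of_isLocalMax_comp {V : Type*} [NormedAddCommGroup V]
    [NormedSpace ℝ V] {n : ℕ} {F : V → E} {φ : E → ℝ} {x : V} (hF : ContDiffAt ℝ 2 F x)
    (hφ : ContDiffAt ℝ 2 φ (F x)) (hmax : IsLocalMax (φ ∘ F) x) {w : Fin n → V}
    {e : OrthonormalBasis (Fin (n + 1)) ℝ E} (hw : ∀ i, e i.succ = fderiv ℝ F x (w i)) :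
    hypersurfaceLaplacian φ (F x) (e 0)
      (∑ i, ⟪fderiv ℝ (fderiv ℝ F) x (w i) (w i), e 0⟫_ℝ) ≤ 0 := by
  have hfst (i : Fin n) : fderiv ℝ φ (F x) (e i.succ) = 0 := by
    rw [hw, ← ContinuousLinearMap.comp_apply, ← fderiv_comp x (hφ.differentiableAt (by simp))
      (hF.differentiableAt (by simp)), hmax.fderiv_eq_zero, zero_apply]
  have hnormal (z : E) : fderiv ℝ φ (F x) z = ⟪z, e 0⟫_ℝ * fderiv ℝ φ (F x) (e 0) := by
    conv_lhs => rw [← e.sum_repr' z, Fin.sum_univ_succ]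
    simp [hfst, real_inner_comm]
  rw [hypersurfaceLaplacian_eq_sum, Finset.sum_mul, ← Finset.sum_add_distrib]
  refine Finset.sum_nonpos fun i _ => ?_
  rw [← hnormal, hw, ← fderiv_fderiv_comp_apply hφ hF]
  exact fderiv_fderiv_nonpos_of_isLocalMax (hφ.comp x hF) hmax _

end HypersurfaceLaplacian

section Chart

variable {n m : ℕ} {M : Type*} [TopologicalSpace M] [ChartedSpace (EuclideanSpace ℝ (Fin n)) M]
  {X : M → EuclideanSpace ℝ (Fin m)}

theorem tendsto_prodMap_extChartAt (q : M) :
    Tendsto (Prod.map (extChartAt (𝓡 n) q) (extChartAt (𝓡 n) q)) (𝓝 (q, q))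
      (𝓝 (extChartAt (𝓡 n) q q, extChartAt (𝓡 n) q q)) :=
  (continuousAt_extChartAt q).prodMap (continuousAt_extChartAt q)

theorem fderiv_comp_extChartAt_symm_self {p : M}
    (hX : MDifferentiableAt (𝓡 n) 𝓘(ℝ, EuclideanSpace ℝ (Fin m)) X p)
    (v : EuclideanSpace ℝ (Fin n)) :
    fderiv ℝ (X ∘ (extChartAt (𝓡 n) p).symm) (extChartAt (𝓡 n) p p) v =
      mvfderiv (𝓡 n) X p v := by
  rw [hX.mvfderiv]
  simp only [ModelWithCorners.range_eq_univ, fderivWithin_univ]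
  rfl

theorem fderiv_comp_extChartAt_symm_mem_range [IsManifold (𝓡 n) 1 M] {p : M}
    {x : EuclideanSpace ℝ (Fin n)} (hx : x ∈ (extChartAt (𝓡 n) p).target)
    (hX : MDifferentiableAt (𝓡 n) 𝓘(ℝ, EuclideanSpace ℝ (Fin m)) X ((extChartAt (𝓡 n) p).symm x))
    (v : EuclideanSpace ℝ (Fin n)) :
    fderiv ℝ (X ∘ (extChartAt (𝓡 n) p).symm) x v ∈
      range (mvfderiv (𝓡 n) X ((extChartAt (𝓡 n) p).symm x)) := by
  have hsymm : MDifferentiableAt 𝓘(ℝ, EuclideanSpace ℝ (Fin n)) (𝓡 n)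
      (extChartAt (𝓡 n) p).symm x :=
    ((contMDiffOn_extChartAt_symm (n := 1) p).contMDiffAt
      ((isOpen_extChartAt_target p).mem_nhds hx)).mdifferentiableAt one_ne_zero
  rw [← mfderiv_eq_fderiv]
  exact ⟨_, (mfderiv_comp_apply x hX hsymm v).symm⟩

theorem contDiffAt_comp_extChartAt_symm {k : WithTop ℕ∞} [IsManifold (𝓡 n) k M]
    (hX : ContMDiff (𝓡 n) 𝓘(ℝ, EuclideanSpace ℝ (Fin m)) k X) (p : M)
    {x : EuclideanSpace ℝ (Fin n)} (hx : x ∈ (extChartAt (𝓡 n) p).target) :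
    ContDiffAt ℝ k (X ∘ (extChartAt (𝓡 n) p).symm) x :=
  (hX.comp_contMDiffOn (contMDiffOn_extChartAt_symm p)).contDiffOn.contDiffAt
    ((isOpen_extChartAt_target p).mem_nhds hx)

theorem meanCurvature_eq_sum {p : M} {ν : EuclideanSpace ℝ (Fin m)}
    (w : Module.Basis (Fin n) ℝ (EuclideanSpace ℝ (Fin n)))
    (hw : Orthonormal ℝ fun i => mvfderiv (𝓡 n) X p (w i)) :
    meanCurvature (n := n) X ν p = ∑ i, secondFundamentalForm X ν p (w i) (w i) := by
  let G : LinearMap.BilinForm ℝ (EuclideanSpace ℝ (Fin n)) :=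
    (innerₗ (EuclideanSpace ℝ (Fin m))).compl₁₂ (mvfderiv (𝓡 n) X p).toLinearMap
      (mvfderiv (𝓡 n) X p).toLinearMap
  let A : LinearMap.BilinForm ℝ (EuclideanSpace ℝ (Fin n)) :=
    LinearMap.mk₂ ℝ (fun v w => secondFundamentalForm X ν p v w)
      (by simp [secondFundamentalForm, inner_add_left])
      (by simp [secondFundamentalForm, inner_smul_left])
      (by simp [secondFundamentalForm, inner_add_left])
      (by simp [secondFundamentalForm, inner_smul_left])
  have hG : LinearMap.BilinForm.toMatrix w G = 1 := by
    ext i j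
    rw [LinearMap.BilinForm.toMatrix_apply, Matrix.one_apply]
    exact orthonormal_iff_ite.1 hw i j
  simpa [meanCurvature, LinearMap.BilinForm.toMatrix_apply, Matrix.trace, A] using!
    trace_toMatrix_inv_mul_toMatrix (EuclideanSpace.basisFun (Fin n) ℝ).toBasis w hG A

end Chart

section ImmersionAsymptotics

open Asymptotics

variable {V E : Type*} [NormedAddCommGroup V] [NormedSpace ℝ V] [FiniteDimensional ℝ V]
  [NormedAddCommGroup E] [NormedSpace ℝ E] {F : V → E} {x₀ : V}

theorem isTheta_sub_of_injective_fderiv (hF : ContDiffAt ℝ 1 F x₀)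
    (hinj : Injective (fderiv ℝ F x₀)) :
    (fun p : V × V => F p.1 - F p.2) =Θ[𝓝 (x₀, x₀)] fun p => p.1 - p.2 :=
  (hF.hasStrictFDerivAt one_ne_zero).isTheta_sub
    (LinearMap.isClosedEmbedding_of_injective (LinearMap.ker_eq_bot.2 hinj)).isInducing

theorem isLittleO_sub_sub_fderiv (hF : ContDiffAt ℝ 1 F x₀) (hinj : Injective (fderiv ℝ F x₀)) :
    (fun p : V × V => F p.1 - F p.2 - fderiv ℝ F p.1 (p.1 - p.2)) =o[𝓝 (x₀, x₀)]
      fun p => F p.1 - F p.2 := by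
  refine IsLittleO.trans_isTheta ?_ (isTheta_sub_of_injective_fderiv hF hinj).symm
  have hvar : (fun p : V × V => (fderiv ℝ F p.1 - fderiv ℝ F x₀) (p.1 - p.2)) =o[𝓝 (x₀, x₀)]
      fun p => p.1 - p.2 := by
    have hcont : (fun p : V × V => fderiv ℝ F p.1 - fderiv ℝ F x₀) =o[𝓝 (x₀, x₀)]
        fun _ => (1 : ℝ) := by
      rw [isLittleO_one_iff, tendsto_sub_nhds_zero_iff]
      exact (hF.continuousAt_fderiv one_ne_zero).tendsto.comp (continuous_fst.tendsto (x₀, x₀))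
    have hmul := hcont.norm_left.mul_isBigO (isBigO_refl (fun p : V × V => ‖p.1 - p.2‖) _)
    simp only [one_mul] at hmul
    exact (IsBigO.of_norm_le fun p => ContinuousLinearMap.le_opNorm _ _).trans_isLittleO
      hmul.of_norm_right
  refine ((hF.hasStrictFDerivAt one_ne_zero).isLittleO.sub hvar).congr_left fun p => ?_
  simp only [sub_apply]
  abel

end ImmersionAsymptotics

section Topology

theorem exists_notMem_forall_dist_le {T Y : Type*} [TopologicalSpace T] [MetricSpace Y] {f : T → Y}
    {C S : Set T} {x : T} (hC : IsCompact C) (hf : ContinuousOn f C) (hinj : InjOn f C)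
    (hCx : C ∈ 𝓝 x) (hS : IsClosed S) (hxS : x ∈ S) (hSx : S ∉ 𝓝 x) :
    ∃ p ∈ C \ S, ∃ q ∈ interior C ∩ S, ∀ q' ∈ C ∩ S, dist (f q) (f p) ≤ dist (f q') (f p) := by
  have hxC : x ∈ C := mem_of_mem_nhds hCx
  have hcont {A : Set T} (hA : A ⊆ C) {y : Y} : ContinuousOn (fun q => dist (f q) y) A :=
    continuous_dist.comp_continuousOn ((hf.mono hA).prodMk continuousOn_const)
  obtain ⟨δ, hδ, hfar⟩ := (hC.diff isOpen_interior).exists_forall_le'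
    (f := fun q => dist (f q) (f x)) (a := 0)
    (hcont sdiff_subset) fun q hq => dist_pos.2 fun h =>
      hq.2 (hinj hq.1 hxC h ▸ mem_interior_iff_mem_nhds.2 hCx)
  have hnear : ∀ᶠ p in 𝓝 x, p ∈ C ∧ dist (f p) (f x) < δ / 2 :=
    (eventually_mem_set.2 hCx).and
      ((hf.continuousAt hCx).eventually (ball_mem_nhds (f x) (half_pos hδ)))
  obtain ⟨p, hpS, hpC, hpx⟩ := ((not_eventually.1 hSx).and_eventually hnear).exists
  obtain ⟨q, hq, hmin⟩ := (hC.inter_right hS).exists_isMinOn ⟨x, hxC, hxS⟩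
    (f := fun q => dist (f q) (f p)) (hcont inter_subset_left)
  refine ⟨p, ⟨hpC, hpS⟩, q, ⟨?_, hq.2⟩, fun q' hq' => hmin hq'⟩
  by_contra hqC
  have hqx : dist (f q) (f p) ≤ dist (f x) (f p) := hmin ⟨hxC, hxS⟩
  have := hfar q ⟨hq.1, hqC⟩
  have := dist_triangle (f q) (f p) (f x)
  rw [dist_comm (f x)] at hqx
  linarith

/-- `u` may have other maxima close to `x`, but `e` breaks the tie. -/
theorem exists_isLocalMax_add_smul {T : Type*} [TopologicalSpace T] [LocallyCompactSpace T]
    {u e : T → ℝ} {x : T} {W : Set T} (hu : Continuous u) (he : Continuous e) (hW : W ∈ 𝓝 x)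
    (hmax : ∀ y ∈ W, u y ≤ u x) (hlt : ∀ y ∈ W, u y = u x → y ≠ x → e y < e x) :
    ∃ ε > (0 : ℝ), ∃ y ∈ W, IsLocalMax (u + ε • e) y := by
  obtain ⟨B, hB, hBW, hBc⟩ := local_compact_nhds hW
  have hxB : x ∈ interior B := mem_interior_iff_mem_nhds.2 hB
  obtain ⟨δ, hδ, hgap⟩ := ((hBc.diff isOpen_interior).inter_right
    (isClosed_le continuous_const he : IsClosed {y | e x ≤ e y})).exists_forall_le'
    (f := fun y => u x - u y) (a := 0) (by fun_prop) fun y hy => by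
      refine sub_pos.2 ((hmax y (hBW hy.1.1)).lt_of_ne fun huy => ?_)
      exact (hlt y (hBW hy.1.1) huy fun hyx => hy.1.2 (hyx ▸ hxB)).not_ge hy.2
  obtain ⟨b, hb⟩ := hBc.bddAbove_image he.continuousOn
  have hbx : e x ≤ b := hb (mem_image_of_mem e (interior_subset hxB))
  set ε := δ / (b - e x + 1)
  have hε : 0 < ε := div_pos hδ (by linarith)
  have hεδ : ε * (b - e x + 1) = δ := div_mul_cancel₀ δ (by linarith)
  have hbdry : ∀ y ∈ B \ interior B, (u + ε • e) y < (u + ε • e) x := by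
    intro y hy
    have huy := hmax y (hBW hy.1)
    have hey : e y ≤ b := hb (mem_image_of_mem e hy.1)
    simp only [Pi.add_apply, Pi.smul_apply, smul_eq_mul]
    rcases le_or_gt (e x) (e y) with hxy | hxy
    · have := hgap y ⟨hy, hxy⟩
      nlinarith
    · nlinarith
  obtain ⟨y, hyB, hy⟩ := hBc.exists_isMaxOn ⟨x, interior_subset hxB⟩
    (f := u + ε • e) (by fun_prop)
  refine ⟨ε, hε, y, hBW hyB, hy.isLocalMax (mem_interior_iff_mem_nhds.1 ?_)⟩
  by_contra hyint
  exact (hbdry y ⟨hyB, hyint⟩).not_ge (hy (interior_subset hxB))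

end Topology

section Barrier

variable {E : Type*} [NormedAddCommGroup E] [InnerProductSpace ℝ E]

theorem sub_midpoint_eq_smul (x a b : E) :
    x - midpoint ℝ a b = (2⁻¹ : ℝ) • ((x - a) + (x - b)) := by
  rw [midpoint_eq_smul_add, invOf_eq_inv]
  module

theorem norm_sub_midpoint_lt {a b x : E} (hx : x ≠ a) (hab : ‖a - b‖ ≤ ‖x - b‖) :
    ‖a - midpoint ℝ a b‖ < ‖x - midpoint ℝ a b‖ := by
  have hpar := parallelogram_law_with_norm ℝ (x - a) (x - b)
  have hxa : 0 < ‖x - a‖ := norm_pos_iff.2 (sub_ne_zero.2 hx)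
  rw [sub_sub_sub_cancel_left, norm_sub_rev b a] at hpar
  rw [sub_midpoint_eq_smul, sub_midpoint_eq_smul, sub_self, zero_add, norm_smul, norm_smul]
  refine mul_lt_mul_of_pos_left (lt_of_pow_lt_pow_left₀ 2 (norm_nonneg _) ?_) (by simp)
  nlinarith [norm_nonneg (a - b)]

theorem abs_inner_sub_midpoint_le {a b x ν : E} {κ : ℝ} (ha : |⟪x - a, ν⟫_ℝ| ≤ κ * ‖x - a‖)
    (hb : |⟪x - b, ν⟫_ℝ| ≤ κ * ‖x - b‖) :
    |⟪x - midpoint ℝ a b, ν⟫_ℝ| ≤ κ / 2 * (‖x - a‖ + ‖x - b‖) := by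
  rw [sub_midpoint_eq_smul, real_inner_smul_left, inner_add_left, abs_mul, abs_of_nonneg (by simp)]
  linarith [abs_add_le ⟪x - a, ν⟫_ℝ ⟪x - b, ν⟫_ℝ]

variable [FiniteDimensional ℝ E] {n : ℕ}

theorem hypersurfaceLaplacian_exp_pos (hE : Module.finrank ℝ E = n + 1) {c x ν : E} {α H : ℝ}
    (hν : ‖ν‖ = 1) (hα : 0 < α)
    (hlarge : n + H * ⟪x - c, ν⟫_ℝ < 2 * α * (‖x - c‖ ^ 2 - ⟪x - c, ν⟫_ℝ ^ 2)) :
    0 < hypersurfaceLaplacian (fun y => Real.exp (-α * ‖y - c‖ ^ 2)) x ν H := by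
  have hderiv : deriv (fun s => Real.exp (-α * s)) = fun s => -α * Real.exp (-α * s) := by
    ext s
    simpa [mul_comm] using (((hasDerivAt_id s).const_mul (-α)).exp).deriv
  rw [hypersurfaceLaplacian_radial (g := fun s => Real.exp (-α * s)) hE (by fun_prop) hν, hderiv,
    deriv_const_mul_field, hderiv]
  have hpos := mul_pos (mul_pos hα (Real.exp_pos (-α * ‖x - c‖ ^ 2))) (sub_pos.2 hlarge)
  linarith

/-- Near `X t₀` the points of the hypersurface see both `X t₀` and `b` almost tangentially, so the
sphere with diameter from `X t₀` to `b` crosses the hypersurface transversally there. -/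
theorem exists_eventually_hypersurfaceLaplacian_exp_pos {T : Type*} [TopologicalSpace T]
    (hE : Module.finrank ℝ E = n + 1) {X N : T → E} {H : T → ℝ} {H₀ : ℝ} {t₀ : T} {b : E}
    (hX : ContinuousAt X t₀) (hN : ∀ t, ‖N t‖ = 1) (hH : ∀ t, |H t| ≤ H₀) (hb : X t₀ ≠ b)
    (ha : ∀ᶠ t in 𝓝 t₀, |⟪X t - X t₀, N t⟫_ℝ| ≤ 1 / 2 * ‖X t - X t₀‖)
    (hb' : ∀ᶠ t in 𝓝 t₀, |⟪X t - b, N t⟫_ℝ| ≤ 1 / 2 * ‖X t - b‖) :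
    ∃ α > 0, ∀ᶠ t in 𝓝 t₀, 0 < hypersurfaceLaplacian
      (fun y => Real.exp (-α * ‖y - midpoint ℝ (X t₀) b‖ ^ 2)) (X t) (N t) (H t) := by
  set c := midpoint ℝ (X t₀) b
  set R := ‖X t₀ - b‖
  have hR : 0 < R := norm_pos_iff.2 (sub_ne_zero.2 hb)
  have hH₀ : 0 ≤ H₀ := (abs_nonneg _).trans (hH t₀)
  let β (t : T) : ℝ := 1 / 4 * (‖X t - X t₀‖ + ‖X t - b‖)
  have hβ : ContinuousAt β t₀ := by fun_prop
  have hβ₀ : β t₀ = R / 4 := by simp [β, R]; ring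
  have hc₀ : ‖X t₀ - c‖ = R / 2 := by
    simp [c, R, norm_smul]; ring
  have hβR : ∀ᶠ t in 𝓝 t₀, β t < R := hβ.eventually_lt_const (by linarith)
  have htransverse : ∀ᶠ t in 𝓝 t₀, R ^ 2 / 8 < ‖X t - c‖ ^ 2 - β t ^ 2 := by
    have hcont : ContinuousAt (fun t => ‖X t - c‖ ^ 2 - β t ^ 2) t₀ := by fun_prop
    exact hcont.eventually_const_lt (by simp only [hβ₀, hc₀]; nlinarith)
  have hα : (n + H₀ * R) < 2 * (4 * (n + H₀ * R) / R ^ 2 + 1) * (R ^ 2 / 8) := by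
    field_simp
    nlinarith
  refine ⟨4 * (n + H₀ * R) / R ^ 2 + 1, by positivity, ?_⟩
  filter_upwards [ha, hb', hβR, htransverse] with t hat hbt hβRt htt
  have hinner : |⟪X t - c, N t⟫_ℝ| ≤ β t :=
    (abs_inner_sub_midpoint_le hat hbt).trans_eq (by simp only [β]; ring)
  refine hypersurfaceLaplacian_exp_pos hE (hN t) (by positivity) ?_
  calc n + H t * ⟪X t - c, N t⟫_ℝ ≤ n + H₀ * R := by
        refine add_le_add_right ((le_abs_self _).trans ?_) _
        rw [abs_mul]
        exact mul_le_mul (hH t) (hinner.trans hβRt.le) (abs_nonneg _) hH₀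
    _ < 2 * (4 * (n + H₀ * R) / R ^ 2 + 1) * (R ^ 2 / 8) := hα
    _ ≤ _ := by
        gcongr
        have := sq_le_sq' (abs_le.1 hinner).1 (abs_le.1 hinner).2
        linarith

end Barrier

section ImmersedHypersurface

variable {n : ℕ} {M : Type*} [TopologicalSpace M] [ChartedSpace (EuclideanSpace ℝ (Fin n)) M]

/-- `X : M → ℝⁿ⁺¹` is a `C²` immersed hypersurface and `N p` is a unit normal vector to it at each
`p`. As in `IsLambdaHypersurface`, the choice of the normal need not be continuous. -/
structure IsImmersedHypersurface (X N : M → EuclideanSpace ℝ (Fin (n + 1))) : Prop where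
  contMDiff : ContMDiff (𝓡 n) 𝓘(ℝ, EuclideanSpace ℝ (Fin (n + 1))) 2 X
  injective_mvfderiv : ∀ p : M, Injective (mvfderiv (𝓡 n) X p)
  norm_normal : ∀ p : M, ‖N p‖ = 1
  inner_mvfderiv_normal : ∀ (p : M) (v : TangentSpace (𝓡 n) p),
    ⟪mvfderiv (𝓡 n) X p v, N p⟫_ℝ = 0

variable {X N : M → EuclideanSpace ℝ (Fin (n + 1))}

theorem IsLambdaHypersurface.isImmersedHypersurface {l : ℝ} (hX : IsLambdaHypersurface X N l) :
    IsImmersedHypersurface X N where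
  contMDiff := hX.smooth.of_le (by norm_cast)
  injective_mvfderiv := hX.immersion
  norm_normal := hX.norm_normal
  inner_mvfderiv_normal := hX.orthogonal

namespace IsImmersedHypersurface

theorem injective_fderiv_comp_extChartAt_symm (hX : IsImmersedHypersurface X N) (q : M) :
    Injective (fderiv ℝ (X ∘ (extChartAt (𝓡 n) q).symm) (extChartAt (𝓡 n) q q)) := by
  have hXq := hX.contMDiff.mdifferentiableAt (x := q) (by simp)
  intro v w hvw
  rw [fderiv_comp_extChartAt_symm_self hXq, fderiv_comp_extChartAt_symm_self hXq] at hvw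
  exact hX.injective_mvfderiv q hvw

variable [IsManifold (𝓡 n) 2 M]

theorem hypersurfaceLaplacian_nonpos_of_isLocalMax (hX : IsImmersedHypersurface X N) {p : M}
    {φ : EuclideanSpace ℝ (Fin (n + 1)) → ℝ} (hφ : ContDiffAt ℝ 2 φ (X p))
    (hmax : IsLocalMax (φ ∘ X) p) :
    hypersurfaceLaplacian φ (X p) (N p) (meanCurvature (n := n) X (N p) p) ≤ 0 := by
  set F := X ∘ (extChartAt (𝓡 n) p).symm
  set x := extChartAt (𝓡 n) p p
  have hFx : F x = X p := by simp [F, x]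
  have hL (v : EuclideanSpace ℝ (Fin n)) : fderiv ℝ F x v = mvfderiv (𝓡 n) X p v :=
    fderiv_comp_extChartAt_symm_self (hX.contMDiff.mdifferentiableAt (by simp)) v
  have hmaxF : IsLocalMax (φ ∘ F) x := by
    have hq : Tendsto (extChartAt (𝓡 n) p).symm (𝓝 x) (𝓝 p) := by
      simpa [x] using (continuousAt_extChartAt_symm (I := 𝓡 n) p).tendsto
    filter_upwards [hq.eventually hmax] with y hy
    rwa [comp_apply, comp_apply, hFx]
  obtain ⟨w, e, he, hw⟩ := exists_basis_orthonormalBasis_adapted (n := n)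
    (L := (fderiv ℝ F x).toLinearMap) (by simp) (by simp)
    (fun v w hvw => hX.injective_mvfderiv p ((hL v).symm.trans (hvw.trans (hL w))))
    (hX.norm_normal p)
    (fun v => (congr_arg (⟪·, N p⟫_ℝ) (hL v)).trans (hX.inner_mvfderiv_normal p v))
  have hframe : Orthonormal ℝ fun i => mvfderiv (𝓡 n) X p (w i) := by
    simpa only [← hL, comp_def, hw] using! e.orthonormal.comp _ (Fin.succ_injective n)
  rw [← hFx] at hφ ⊢
  rw [meanCurvature_eq_sum w hframe, ← he]
  exact hypersurfaceLaplacian_nonpos_of_isLocalMax_comp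
    (contDiffAt_comp_extChartAt_symm hX.contMDiff p (mem_extChartAt_target p)) hφ hmaxF hw

theorem eventually_eq_of_apply_eq (hX : IsImmersedHypersurface X N) (q : M) :
    ∀ᶠ p in 𝓝 (q, q), X p.1 = X p.2 → p.1 = p.2 := by
  have hsource := extChartAt_source_mem_nhds (I := 𝓡 n) q
  have hF := (contDiffAt_comp_extChartAt_symm hX.contMDiff q (mem_extChartAt_target q)).of_le
    one_le_two
  have hO := (isTheta_sub_of_injective_fderiv hF
    (hX.injective_fderiv_comp_extChartAt_symm q)).isBigO_symm.eq_zero_imp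
  filter_upwards [(tendsto_prodMap_extChartAt q).eventually hO, prod_mem_nhds hsource hsource]
    with p hp ⟨hp₁, hp₂⟩ hXp
  simp only [Prod.map_fst, Prod.map_snd, comp_apply, PartialEquiv.left_inv _ hp₁,
    PartialEquiv.left_inv _ hp₂, sub_eq_zero] at hp
  exact (extChartAt (𝓡 n) q).injOn hp₁ hp₂ (hp hXp)

theorem eventually_abs_inner_sub_le (hX : IsImmersedHypersurface X N) (q : M) {κ : ℝ}
    (hκ : 0 < κ) : ∀ᶠ p in 𝓝 (q, q), |⟪X p.1 - X p.2, N p.1⟫_ℝ| ≤ κ * ‖X p.1 - X p.2‖ := by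
  have hsource := extChartAt_source_mem_nhds (I := 𝓡 n) q
  have hF := (contDiffAt_comp_extChartAt_symm hX.contMDiff q (mem_extChartAt_target q)).of_le
    one_le_two
  have ho := (isLittleO_sub_sub_fderiv hF
    (hX.injective_fderiv_comp_extChartAt_symm q)).bound hκ
  filter_upwards [(tendsto_prodMap_extChartAt q).eventually ho, prod_mem_nhds hsource hsource]
    with p hp ⟨hp₁, hp₂⟩
  simp only [Prod.map_fst, Prod.map_snd, comp_apply, PartialEquiv.left_inv _ hp₁,
    PartialEquiv.left_inv _ hp₂] at hp
  set v := extChartAt (𝓡 n) q p.1 - extChartAt (𝓡 n) q p.2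
  obtain ⟨w, hw⟩ := fderiv_comp_extChartAt_symm_mem_range (PartialEquiv.map_source _ hp₁)
    (hX.contMDiff.mdifferentiableAt (by simp)) v
  have hnormal : ⟪fderiv ℝ (X ∘ (extChartAt (𝓡 n) q).symm) (extChartAt (𝓡 n) q p.1) v,
      N p.1⟫_ℝ = 0 := by
    have hperp := hX.inner_mvfderiv_normal _ w
    rwa [hw, PartialEquiv.left_inv _ hp₁] at hperp
  rw [← sub_zero ⟪X p.1 - X p.2, N p.1⟫_ℝ, ← hnormal, ← inner_sub_left]
  exact (abs_real_inner_le_norm _ _).trans (by rwa [hX.norm_normal, mul_one])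

/-- Hopf's strong maximum principle. At a boundary point `q₀` of the set where `φ ∘ X` attains the
maximum, touched from outside by a ball around a nearby point `X p`, one perturbs `φ` by a Gaussian
centred at the midpoint of `X p` and `X q₀`. -/
theorem eventually_eq_of_isLocalMax (hX : IsImmersedHypersurface X N) {H₀ : ℝ}
    (hH₀ : ∀ p, |meanCurvature (n := n) X (N p) p| ≤ H₀) {φ : EuclideanSpace ℝ (Fin (n + 1)) → ℝ}
    (hφ : ContDiff ℝ 2 φ)
    (hsub : ∀ p, 0 ≤ hypersurfaceLaplacian φ (X p) (N p) (meanCurvature (n := n) X (N p) p))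
    {q : M} (hmax : IsLocalMax (φ ∘ X) q) : ∀ᶠ p in 𝓝 q, φ (X p) = φ (X q) := by
  have := Manifold.locallyCompact_of_finiteDimensional (M := M) (𝓡 n)
  have hXc : Continuous X := hX.contMDiff.continuous
  have hnear := (hX.eventually_eq_of_apply_eq q).and
    (hX.eventually_abs_inner_sub_le q (κ := 1 / 2) (by norm_num))
  rw [nhds_prod_eq, eventually_prod_self_iff'] at hnear
  obtain ⟨U, hU, hUX⟩ := hnear
  obtain ⟨C, hC, hCU, hCc⟩ := local_compact_nhds (inter_mem hU hmax)
  by_contra hne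
  obtain ⟨p, ⟨hpC, hpS⟩, q₀, ⟨hq₀C, hq₀S⟩, hmin⟩ := exists_notMem_forall_dist_le (f := X) hCc
    hXc.continuousOn (fun a ha b hb => (hUX a (hCU ha).1 b (hCU hb).1).1) hC
    (isClosed_eq (hφ.continuous.comp hXc) continuous_const) rfl hne
  have hφq₀ : φ (X q₀) = φ (X q) := hq₀S
  have hCq₀ : ∀ᶠ t in 𝓝 q₀, t ∈ C := mem_interior_iff_mem_nhds.1 hq₀C
  have htangent {b : M} (hb : b ∈ C) :
      ∀ᶠ t in 𝓝 q₀, |⟪X t - X b, N t⟫_ℝ| ≤ 1 / 2 * ‖X t - X b‖ :=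
    hCq₀.mono fun t ht => (hUX t (hCU ht).1 b (hCU hb).1).2
  obtain ⟨α, hα, hpos⟩ := exists_eventually_hypersurfaceLaplacian_exp_pos (n := n) (by simp)
    hXc.continuousAt hX.norm_normal hH₀ (fun h => hpS ((congr_arg φ h).symm.trans hφq₀))
    (htangent (interior_subset hq₀C)) (htangent hpC)
  set c := midpoint ℝ (X q₀) (X p)
  set ψ : EuclideanSpace ℝ (Fin (n + 1)) → ℝ := fun y => Real.exp (-α * ‖y - c‖ ^ 2)
  have hψ : ContDiff ℝ 2 ψ := ((contDiff_norm_sub_sq c).const_smul (-α)).exp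
  obtain ⟨ε, hε, t, ⟨-, htpos⟩, htmax⟩ := exists_isLocalMax_add_smul (u := φ ∘ X) (e := ψ ∘ X)
    (hφ.continuous.comp hXc) (hψ.continuous.comp hXc) (hCq₀.and hpos)
    (fun y hy => (hCU hy.1).2.trans_eq hφq₀.symm) fun y hy hφy hyq₀ => by
      have hyS := hmin y ⟨hy.1, hφy.trans hφq₀⟩
      rw [dist_eq_norm, dist_eq_norm] at hyS
      have hyX : X y ≠ X q₀ := fun h =>
        hyq₀ ((hUX y (hCU hy.1).1 q₀ (hCU (interior_subset hq₀C)).1).1 h)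
      have := norm_sub_midpoint_lt hyX hyS
      simp only [comp_apply, ψ, Real.exp_lt_exp, neg_mul, neg_lt_neg_iff]
      gcongr
  have hle := hX.hypersurfaceLaplacian_nonpos_of_isLocalMax
    (φ := φ + ε • ψ) (hφ.add (hψ.const_smul ε)).contDiffAt htmax
  rw [hypersurfaceLaplacian_add (ψ := ε • ψ) hφ.contDiffAt (hψ.const_smul ε).contDiffAt,
    hypersurfaceLaplacian_const_smul hψ.contDiffAt] at hle
  exact hle.not_gt (add_pos_of_nonneg_of_pos (hsub t) (mul_pos hε htpos))

theorem strong_maximum_principle [PreconnectedSpace M] (hX : IsImmersedHypersurface X N) {H₀ : ℝ}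
    (hH₀ : ∀ p, |meanCurvature (n := n) X (N p) p| ≤ H₀) {φ : EuclideanSpace ℝ (Fin (n + 1)) → ℝ}
    (hφ : ContDiff ℝ 2 φ)
    (hsub : ∀ p, 0 ≤ hypersurfaceLaplacian φ (X p) (N p) (meanCurvature (n := n) X (N p) p))
    {q : M} (hmax : ∀ p, φ (X p) ≤ φ (X q)) (p : M) : φ (X p) = φ (X q) := by
  have hclopen : IsClopen {p | φ (X p) = φ (X q)} := by
    refine ⟨isClosed_eq (hφ.continuous.comp hX.contMDiff.continuous) continuous_const,
      isOpen_iff_mem_nhds.2 fun p (hp : φ (X p) = φ (X q)) => ?_⟩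
    have := hX.eventually_eq_of_isLocalMax hH₀ hφ hsub (q := p)
      (Eventually.of_forall fun t => (hmax t).trans_eq hp.symm)
    exact this.mono fun t ht => ht.trans hp
  exact (hclopen.eq_univ ⟨q, rfl⟩).ge (mem_univ p)

end IsImmersedHypersurface

end ImmersedHypersurface

namespace IsLambdaHypersurface

variable {n : ℕ} {M : Type*} [TopologicalSpace M] [ChartedSpace (EuclideanSpace ℝ (Fin n)) M]
  {X N : M → EuclideanSpace ℝ (Fin (n + 1))} {l : ℝ}

theorem hypersurfaceLaplacian_const_mul_norm_sq (hX : IsLambdaHypersurface X N l) (a : ℝ) (p : M) :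
    hypersurfaceLaplacian (fun y => a * ‖y‖ ^ 2) (X p) (N p) (meanCurvature (n := n) X (N p) p) =
      2 * a * (n + l ^ 2 / 4 - (meanCurvature (n := n) X (N p) p - l / 2) ^ 2) := by
  have hradial := hypersurfaceLaplacian_radial (n := n) (g := fun s => a * s) (c := 0) (x := X p)
    (by simp) (by fun_prop) (hX.norm_normal p) (meanCurvature (n := n) X (N p) p)
  have hderiv : deriv (fun s : ℝ => a * s) = fun _ => a := by
    ext s
    simp
  simp only [hderiv, deriv_const, sub_zero] at hradial
  rw [hradial, ← hX.equation p]
  ring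

theorem abs_meanCurvature_le {p : M}
    (hH : (meanCurvature (n := n) X (N p) p - l / 2) ^ 2 ≤ n + l ^ 2 / 4) :
    |meanCurvature (n := n) X (N p) p| ≤ √(n + l ^ 2 / 4) + |l / 2| := by
  have := (abs_sub_abs_le_abs_sub _ _).trans (Real.abs_le_sqrt hH)
  linarith

variable [IsManifold (𝓡 n) 2 M]

theorem exists_norm_eq [CompactSpace M] [ConnectedSpace M] (hX : IsLambdaHypersurface X N l)
    (hH : ∀ p : M, (meanCurvature (n := n) X (N p) p - l / 2) ^ 2 ≤ n + l ^ 2 / 4) :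
    ∃ ρ : ℝ, ∀ p, ‖X p‖ = ρ := by
  obtain ⟨q, -, hq⟩ := isCompact_univ.exists_isMaxOn (univ_nonempty (α := M))
    hX.smooth.continuous.norm.continuousOn
  refine ⟨‖X q‖, fun p => ?_⟩
  have hmax := hX.isImmersedHypersurface.strong_maximum_principle (φ := fun y => 1 * ‖y‖ ^ 2)
    (fun p => abs_meanCurvature_le (hH p)) (contDiff_const.mul (contDiff_norm_sq ℝ))
    (fun p => by
      rw [hX.hypersurfaceLaplacian_const_mul_norm_sq]
      linarith [hH p])
    (q := q) (fun p => by simpa using pow_le_pow_left₀ (norm_nonneg _) (hq (mem_univ p)) 2) p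
  simpa using hmax

theorem sq_eq_of_norm_eq (hX : IsLambdaHypersurface X N l) {ρ : ℝ} (hρ : ∀ p, ‖X p‖ = ρ) (p : M) :
    (meanCurvature (n := n) X (N p) p - l / 2) ^ 2 = n + l ^ 2 / 4 := by
  have hle (a : ℝ) := hX.isImmersedHypersurface.hypersurfaceLaplacian_nonpos_of_isLocalMax
    (p := p) (φ := fun y => a * ‖y‖ ^ 2) (contDiff_const.mul (contDiff_norm_sq ℝ)).contDiffAt
    (Eventually.of_forall fun q => by simp [hρ])
  simp only [hX.hypersurfaceLaplacian_const_mul_norm_sq] at hle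
  linarith [hle 1, hle (-1)]

theorem pos_of_norm_eq [Nonempty M] (hn : 1 ≤ n) (hX : IsLambdaHypersurface X N l) {ρ : ℝ}
    (hρ : ∀ p, ‖X p‖ = ρ) : 0 < ρ := by
  obtain ⟨p⟩ := ‹Nonempty M›
  refine lt_of_le_of_ne (hρ p ▸ norm_nonneg _) fun hρ0 => ?_
  have hH : meanCurvature (n := n) X (N p) p = l := by
    simpa [norm_eq_zero.1 ((hρ p).trans hρ0.symm)] using hX.equation p
  have hsq := hX.sq_eq_of_norm_eq hρ p
  rw [hH] at hsq
  have hn' : (1 : ℝ) ≤ n := by exact_mod_cast hn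
  linarith

end IsLambdaHypersurface

section LocalDiffeomorph

variable {E F G : Type*} [NormedAddCommGroup E] [NormedSpace ℝ E] [NormedAddCommGroup F]
  [NormedSpace ℝ F] [NormedAddCommGroup G] [NormedSpace ℝ G]
  {M M' M'' : Type*} [TopologicalSpace M] [ChartedSpace E M] [TopologicalSpace M']
  [ChartedSpace F M'] [TopologicalSpace M''] [ChartedSpace G M'']
  {k : WithTop ℕ∞} {f : M → M'} {p : M}

theorem isLocalDiffeomorphAt_of_openPartialHomeomorph (e : OpenPartialHomeomorph M M')
    {s : Set M} (hs : IsOpen s) (hps : p ∈ s) (hpe : p ∈ e.source)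
    (he : ContMDiffOn 𝓘(ℝ, E) 𝓘(ℝ, F) k e (e.source ∩ s))
    (he' : ContMDiffOn 𝓘(ℝ, F) 𝓘(ℝ, E) k e.symm (e.target ∩ e.symm ⁻¹' s))
    (hf : EqOn f e (e.source ∩ s)) : IsLocalDiffeomorphAt 𝓘(ℝ, E) 𝓘(ℝ, F) k f p :=
  ⟨{ toPartialEquiv := (e.restrOpen s hs).toPartialEquiv
     open_source := (e.restrOpen s hs).open_source
     open_target := (e.restrOpen s hs).open_target
     contMDiffOn_toFun := he
     contMDiffOn_invFun := he' }, ⟨hpe, hps⟩, hf⟩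

theorem isLocalDiffeomorphAt_congr (hf : IsLocalDiffeomorphAt 𝓘(ℝ, E) 𝓘(ℝ, F) k f p) {g : M → M'}
    (h : g =ᶠ[𝓝 p] f) : IsLocalDiffeomorphAt 𝓘(ℝ, E) 𝓘(ℝ, F) k g p := by
  obtain ⟨Φ, hp, hΦ⟩ := hf
  obtain ⟨s, hgf, hs, hps⟩ := mem_nhds_iff.1 h
  exact isLocalDiffeomorphAt_of_openPartialHomeomorph Φ.toOpenPartialHomeomorph hs hps hp
    (Φ.contMDiffOn_toFun.mono inter_subset_left) (Φ.contMDiffOn_invFun.mono inter_subset_left)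
    fun x hx => (hgf hx.2).trans (hΦ hx.1)

theorem isLocalDiffeomorphAt_chartAt [IsManifold 𝓘(ℝ, E) k M] (p : M) :
    IsLocalDiffeomorphAt 𝓘(ℝ, E) 𝓘(ℝ, E) k (chartAt E p) p :=
  isLocalDiffeomorphAt_of_openPartialHomeomorph (chartAt E p) isOpen_univ (mem_univ p)
    (mem_chart_source E p) (contMDiffOn_chart.mono inter_subset_left)
    (contMDiffOn_chart_symm.mono inter_subset_left) (eqOn_refl _ _)

theorem isLocalDiffeomorphAt_chartAt_symm [IsManifold 𝓘(ℝ, E) k M] (p : M) :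
    IsLocalDiffeomorphAt 𝓘(ℝ, E) 𝓘(ℝ, E) k (chartAt E p).symm (chartAt E p p) :=
  isLocalDiffeomorphAt_of_openPartialHomeomorph (chartAt E p).symm isOpen_univ (mem_univ _)
    (mem_chart_target E p) (contMDiffOn_chart_symm.mono inter_subset_left)
    (contMDiffOn_chart.mono inter_subset_left) (eqOn_refl _ _)

theorem isLocalDiffeomorphAt_of_comp_left {g : M' → M''} (hfc : ContinuousAt f p)
    (hg : IsLocalDiffeomorphAt 𝓘(ℝ, F) 𝓘(ℝ, G) k g (f p))
    (hgf : IsLocalDiffeomorphAt 𝓘(ℝ, E) 𝓘(ℝ, G) k (g ∘ f) p) :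
    IsLocalDiffeomorphAt 𝓘(ℝ, E) 𝓘(ℝ, F) k f p :=
  isLocalDiffeomorphAt_congr (hgf.comp 𝓘(ℝ, F) _ hg.localInverse_isLocalDiffeomorphAt)
    (hfc.eventually (hg.localInverse_eventuallyEq_left.mono fun _ h => h.symm))

theorem isLocalDiffeomorphAt_of_comp_right {g : M' → M''}
    (hf : IsLocalDiffeomorphAt 𝓘(ℝ, E) 𝓘(ℝ, F) k f p)
    (hgf : IsLocalDiffeomorphAt 𝓘(ℝ, E) 𝓘(ℝ, G) k (g ∘ f) p) :
    IsLocalDiffeomorphAt 𝓘(ℝ, F) 𝓘(ℝ, G) k g (f p) := by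
  have hp : hf.localInverse (f p) = p := hf.localInverse_left_inv hf.localInverse_mem_target
  refine isLocalDiffeomorphAt_congr
    (hf.localInverse_isLocalDiffeomorphAt.comp 𝓘(ℝ, G) _ (hp.symm ▸ hgf)) ?_
  filter_upwards [hf.localInverse_eventuallyEq_right] with y hy
  exact congrArg g hy.symm

theorem isLocalDiffeomorphAt_of_contDiffOn [CompleteSpace E] {g : E → F} {a : E} {s : Set E}
    (hs : IsOpen s) (ha : a ∈ s) (hg : ContDiffOn ℝ k g s) (hk : k ≠ 0)
    (hinv : (fderiv ℝ g a).IsInvertible) : IsLocalDiffeomorphAt 𝓘(ℝ, E) 𝓘(ℝ, F) k g a := by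
  obtain ⟨L, hL⟩ := hinv
  have hderiv {x : E} (hx : x ∈ s) : HasFDerivAt g (fderiv ℝ g x) x :=
    ((hg.contDiffAt (hs.mem_nhds hx)).differentiableAt hk).hasFDerivAt
  set e := (hg.contDiffAt (hs.mem_nhds ha)).toOpenPartialHomeomorph g (hL ▸ hderiv ha) hk
  have hopen : IsOpen {x ∈ s | (fderiv ℝ g x).IsInvertible} :=
    (hg.continuousOn_fderiv_of_isOpen hs
      (ENat.one_le_iff_ne_zero_withTop.2 hk)).isOpen_inter_preimage hs ContinuousLinearEquiv.isOpen
  refine isLocalDiffeomorphAt_of_openPartialHomeomorph e hopen ⟨ha, L, hL⟩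
    (ContDiffAt.mem_toOpenPartialHomeomorph_source _ _ _)
    (hg.contMDiffOn.mono fun x hx => hx.2.1) ?_ (eqOn_refl _ _)
  rintro y ⟨hy, hys, L', hL'⟩
  exact (e.contDiffAt_symm hy (hL' ▸ hderiv hys)
    (hg.contDiffAt (hs.mem_nhds hys))).contMDiffAt.contMDiffWithinAt

theorem isLocalDiffeomorphAt_of_isInvertible_mfderiv [CompleteSpace E] [IsManifold 𝓘(ℝ, E) k M]
    [IsManifold 𝓘(ℝ, F) k M'] (hf : ContMDiff 𝓘(ℝ, E) 𝓘(ℝ, F) k f) (hk : k ≠ 0)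
    (hinv : (mfderiv 𝓘(ℝ, E) 𝓘(ℝ, F) f p).IsInvertible) :
    IsLocalDiffeomorphAt 𝓘(ℝ, E) 𝓘(ℝ, F) k f p := by
  set φ := chartAt E p
  set ψ := chartAt F (f p)
  set g := ψ ∘ f ∘ φ.symm
  have hg : ContDiffOn ℝ k g (φ.target ∩ φ.symm ⁻¹' (f ⁻¹' ψ.source)) := by
    rw [← contMDiffOn_iff_contDiffOn]
    exact contMDiffOn_chart.comp
      (hf.comp_contMDiffOn (contMDiffOn_chart_symm.mono inter_subset_left)) fun x hx => hx.2
  have hfderiv : fderiv ℝ g (φ p) = mfderiv 𝓘(ℝ, E) 𝓘(ℝ, F) f p := by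
    rw [(hf.mdifferentiableAt hk).mfderiv, ModelWithCorners.range_eq_univ, fderivWithin_univ]
    rfl
  have hlocal : IsLocalDiffeomorphAt 𝓘(ℝ, E) 𝓘(ℝ, F) k g (φ p) :=
    isLocalDiffeomorphAt_of_contDiffOn
      (φ.isOpen_inter_preimage_symm (ψ.open_source.preimage hf.continuous))
      ⟨mem_chart_target E p, by simp [φ, ψ]⟩ hg hk (hfderiv ▸ hinv)
  have hgφ : (g ∘ chartAt E p) p = ψ (f p) := by simp [g, φ]
  refine isLocalDiffeomorphAt_congr (((isLocalDiffeomorphAt_chartAt p).comp _ _ hlocal).comp _ _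
    (g := ψ.symm) (hgφ ▸ isLocalDiffeomorphAt_chartAt_symm (f p))) ?_
  filter_upwards [chart_source_mem_nhds E p,
    hf.continuous.continuousAt.preimage_mem_nhds (chart_source_mem_nhds F (f p))] with x hx hfx
  change f x = ψ.symm (ψ (f (φ.symm (φ x))))
  rw [φ.left_inv hx, ψ.left_inv hfx]

theorem isLocalDiffeomorphAt_of_injective_mfderiv [FiniteDimensional ℝ E] [FiniteDimensional ℝ F]
    (hdim : Module.finrank ℝ E = Module.finrank ℝ F) [IsManifold 𝓘(ℝ, E) k M]
    [IsManifold 𝓘(ℝ, F) k M'] (hf : ContMDiff 𝓘(ℝ, E) 𝓘(ℝ, F) k f) (hk : k ≠ 0)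
    (hinj : Injective (mfderiv 𝓘(ℝ, E) 𝓘(ℝ, F) f p)) :
    IsLocalDiffeomorphAt 𝓘(ℝ, E) 𝓘(ℝ, F) k f p := by
  have : CompleteSpace E := FiniteDimensional.complete ℝ E
  have hinv (L : E →L[ℝ] F) (hL : Injective L) : L.IsInvertible :=
    ⟨(LinearMap.linearEquivOfInjective L.toLinearMap hL hdim).toContinuousLinearEquiv, rfl⟩
  exact isLocalDiffeomorphAt_of_isInvertible_mfderiv hf hk (hinv _ hinj)

end LocalDiffeomorph

section Sphere

variable {n : ℕ} {M : Type*} [TopologicalSpace M] [ChartedSpace (EuclideanSpace ℝ (Fin n)) M]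
  {X : M → EuclideanSpace ℝ (Fin (n + 1))}
  {Φ : M → sphere (0 : EuclideanSpace ℝ (Fin (n + 1))) 1}

theorem contMDiff_smul_coe_sphere (r : ℝ) :
    ContMDiff (𝓡 n) 𝓘(ℝ, EuclideanSpace ℝ (Fin (n + 1))) ∞
      fun y : sphere (0 : EuclideanSpace ℝ (Fin (n + 1))) 1 =>
        r • (y : EuclideanSpace ℝ (Fin (n + 1))) := by
  have := Fact.mk (@finrank_euclideanSpace_fin ℝ _ (n + 1))
  exact (contDiff_const_smul r).contMDiff.comp contMDiff_coe_sphere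

theorem mvfderiv_smul_coe_sphere {p : M} (hΦ : MDifferentiableAt (𝓡 n) (𝓡 n) Φ p) (r : ℝ)
    (v : TangentSpace (𝓡 n) p) :
    mvfderiv (𝓡 n) (fun y : sphere (0 : EuclideanSpace ℝ (Fin (n + 1))) 1 =>
        r • (y : EuclideanSpace ℝ (Fin (n + 1)))) (Φ p) (mfderiv (𝓡 n) (𝓡 n) Φ p v) =
      mvfderiv (𝓡 n) (fun q => r • (Φ q : EuclideanSpace ℝ (Fin (n + 1)))) p v :=
  (mfderiv_comp_apply p ((contMDiff_smul_coe_sphere r).mdifferentiableAt (by simp)) hΦ v).symm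

theorem isIsometricToSphere_of_isLocalDiffeomorph {r : ℝ}
    (hΦ : IsLocalDiffeomorph (𝓡 n) (𝓡 n) ∞ Φ) (hbij : Bijective Φ)
    (h : ∀ p v w, firstFundamentalForm (n := n)
      (fun q => r • (Φ q : EuclideanSpace ℝ (Fin (n + 1)))) p v w =
        firstFundamentalForm X p v w) : IsIsometricToSphere X r := by
  refine ⟨hΦ.diffeomorphOfBijective hbij, fun p v w => ?_⟩
  change firstFundamentalForm _ (Φ p) (mfderiv (𝓡 n) (𝓡 n) Φ p v) (mfderiv (𝓡 n) (𝓡 n) Φ p w) = _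
  rw [← h]
  simp only [firstFundamentalForm,
    mvfderiv_smul_coe_sphere (hΦ.contMDiff.mdifferentiableAt (by simp))]

theorem exists_isLocalDiffeomorph_sphere [IsManifold (𝓡 n) ∞ M]
    (hX : ContMDiff (𝓡 n) 𝓘(ℝ, EuclideanSpace ℝ (Fin (n + 1))) ∞ X)
    (himm : ∀ p, Injective (mvfderiv (𝓡 n) X p)) {ρ : ℝ} (hρ : 0 < ρ) (h : ∀ p, ‖X p‖ = ρ) :
    ∃ Y : M → sphere (0 : EuclideanSpace ℝ (Fin (n + 1))) 1,
      IsLocalDiffeomorph (𝓡 n) (𝓡 n) ∞ Y ∧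
        X = fun p => ρ • (Y p : EuclideanSpace ℝ (Fin (n + 1))) := by
  have := Fact.mk (@finrank_euclideanSpace_fin ℝ _ (n + 1))
  have hsphere (p : M) : ρ⁻¹ • X p ∈ sphere (0 : EuclideanSpace ℝ (Fin (n + 1))) 1 := by
    rw [mem_sphere_zero_iff_norm, norm_smul, h, norm_inv, Real.norm_of_nonneg hρ.le,
      inv_mul_cancel₀ hρ.ne']
  have hY : ContMDiff (𝓡 n) (𝓡 n) ∞ (codRestrict (fun p => ρ⁻¹ • X p) _ hsphere) :=
    ((contDiff_const_smul ρ⁻¹).contMDiff.comp hX).codRestrict_sphere hsphere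
  have hYX : X = fun p => ρ • (codRestrict (fun p => ρ⁻¹ • X p) _ hsphere p :
      EuclideanSpace ℝ (Fin (n + 1))) := by
    funext p
    exact (smul_inv_smul₀ hρ.ne' (X p)).symm
  refine ⟨_, fun p => isLocalDiffeomorphAt_of_injective_mfderiv rfl hY (by simp) ?_, hYX⟩
  have hinj := himm p
  rw [hYX] at hinj
  refine Injective.of_comp (f := mvfderiv (𝓡 n)
    (fun y : sphere (0 : EuclideanSpace ℝ (Fin (n + 1))) 1 =>
      ρ • (y : EuclideanSpace ℝ (Fin (n + 1)))) _) ?_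
  convert hinj using 1
  exact funext fun v => mvfderiv_smul_coe_sphere (hY.mdifferentiableAt (by simp)) ρ v

end Sphere

section Covering

variable {E X A : Type*} [TopologicalSpace E] [TopologicalSpace X] [TopologicalSpace A] {f : E → X}

theorem exists_section_of_openPartialHomeomorph [SimplyConnectedSpace A]
    [LocallyPathConnectedSpace A] (hf : IsCoveringMap f) {h : OpenPartialHomeomorph X A}
    (hh : h.target = univ) {e₀ : E} (he₀ : f e₀ ∈ h.source) :
    ∃ s : X → E, ContinuousOn s h.source ∧ s (f e₀) = e₀ ∧ ∀ x ∈ h.source, f (s x) = x := by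
  have hsymm : Continuous h.symm := continuousOn_univ.1 (hh ▸ h.continuousOn_symm)
  obtain ⟨σ, ⟨hσ₀, hσ⟩, -⟩ := hf.existsUnique_continuousMap_lifts ⟨h.symm, hsymm⟩ (h (f e₀)) e₀
    (h.left_inv he₀).symm
  refine ⟨σ ∘ h, σ.continuous.comp_continuousOn h.continuousOn, hσ₀, fun x hx => ?_⟩
  exact (congrFun hσ (h x)).trans (h.left_inv hx)

theorem exists_continuous_section_of_union (hf : IsCoveringMap f) {U V : Set X} (hU : IsOpen U)
    (hV : IsOpen V) (hUV : U ∪ V = univ) (hconn : IsPreconnected (U ∩ V)) {s t : X → E}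
    (hs : ContinuousOn s U) (ht : ContinuousOn t V) (hfs : ∀ x ∈ U, f (s x) = x)
    (hft : ∀ x ∈ V, f (t x) = x) {x₀ : X} (hx₀ : x₀ ∈ U ∩ V) (hst : s x₀ = t x₀) :
    ∃ g : X → E, Continuous g ∧ f ∘ g = id := by
  classical
  have heq : EqOn s t (U ∩ V) :=
    hf.eqOn_of_comp_eqOn hconn (hs.mono inter_subset_left) (ht.mono inter_subset_right)
      (fun x hx => (hfs x hx.1).trans (hft x hx.2).symm) hx₀ hst
  have hgs : EqOn (U.piecewise s t) s U := U.piecewise_eqOn s t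
  have hgt : EqOn (U.piecewise s t) t V := fun x hxV => by
    by_cases hxU : x ∈ U
    · exact (hgs hxU).trans (heq ⟨hxU, hxV⟩)
    · exact piecewise_eq_of_notMem U s t hxU
  have hcover (x : X) : x ∈ U ∨ x ∈ V := hUV.symm.subset (mem_univ x)
  refine ⟨U.piecewise s t, continuous_iff_continuousAt.2 fun x => ?_, funext fun x => ?_⟩
  · rcases hcover x with hx | hx
    · exact (hs.congr hgs).continuousAt (hU.mem_nhds hx)
    · exact (ht.congr hgt).continuousAt (hV.mem_nhds hx)
  · rcases hcover x with hx | hx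
    · exact (congrArg f (hgs hx)).trans (hfs x hx)
    · exact (congrArg f (hgt hx)).trans (hft x hx)

theorem bijective_of_continuous_section [PreconnectedSpace E] [Nonempty X] (hf : IsCoveringMap f)
    {s : X → E} (hs : Continuous s) (hfs : f ∘ s = id) : Bijective f := by
  obtain ⟨x⟩ := ‹Nonempty X›
  have hfs' : LeftInverse f s := congrFun hfs
  have hsf : s ∘ f = id := hf.eq_of_comp_eq (hs.comp hf.continuous) continuous_id
    (by rw [← comp_assoc, hfs, id_comp, comp_id]) (s x) (congrArg s (hfs' x))
  exact ⟨LeftInverse.injective (congrFun hsf), hfs'.surjective⟩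

variable {V : Type*} [NormedAddCommGroup V] [InnerProductSpace ℝ V]

theorem isConnected_sphere_compl_pair_neg (hV : 2 < Module.finrank ℝ V) (v : sphere (0 : V) 1) :
    IsConnected ({v}ᶜ ∩ {-v}ᶜ : Set (sphere (0 : V) 1)) := by
  set h := stereographic (norm_eq_of_mem_sphere v)
  obtain ⟨n, hn⟩ : ∃ n, Module.finrank ℝ V = n + 1 := Nat.exists_eq_succ_of_ne_zero (by omega)
  have := Fact.mk hn
  have hrank : 1 < Module.rank ℝ (ℝ ∙ (v : V))ᗮ := Module.lt_rank_of_lt_finrank (by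
    rw [Submodule.finrank_orthogonal_span_singleton (n := n) (ne_zero_of_mem_unit_sphere v)]; omega)
  have himage : h.symm '' {0}ᶜ = {v}ᶜ ∩ {-v}ᶜ := by
    have hneg : h.symm 0 = -v := by
      rw [← stereographic_apply_neg v]
      exact h.left_inv (ne_neg_of_mem_unit_sphere ℝ v).symm
    rw [image_compl_eq_range_sdiff_image (isOpenEmbedding_stereographic_symm _).injective,
      range_stereographic_symm _ v.2, image_singleton, hneg]
    rfl
  rw [← himage]
  exact (isConnected_compl_singleton_of_one_lt_rank hrank 0).image _
    (isOpenEmbedding_stereographic_symm _).continuous.continuousOn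

theorem bijective_of_isCoveringMap_sphere (hV : 2 < Module.finrank ℝ V) [ConnectedSpace E]
    {f : E → sphere (0 : V) 1} (hf : IsCoveringMap f) : Bijective f := by
  obtain ⟨e₀⟩ := (inferInstance : Nonempty E)
  set v := -f e₀
  have hne (x : sphere (0 : V) 1) : x ≠ -x := ne_neg_of_mem_unit_sphere ℝ x
  obtain ⟨s, hs, -, hfs⟩ := exists_section_of_openPartialHomeomorph hf
    (stereographic_target (norm_eq_of_mem_sphere v)) (hne (f e₀))
  obtain ⟨x₀, hx₀⟩ := (isConnected_sphere_compl_pair_neg hV v).nonempty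
  have hfx₀ : f (s x₀) = x₀ := hfs x₀ hx₀.1
  obtain ⟨t, ht, htx₀, hft⟩ := exists_section_of_openPartialHomeomorph hf
    (stereographic_target (norm_eq_of_mem_sphere (-v))) (e₀ := s x₀) (hfx₀.symm ▸ hx₀.2)
  rw [hfx₀] at htx₀
  have hcover : ({v}ᶜ ∪ {-v}ᶜ : Set (sphere (0 : V) 1)) = univ := by
    rw [← compl_inter, compl_univ_iff, singleton_inter_eq_empty]
    exact hne v
  obtain ⟨g, hg, hfg⟩ := exists_continuous_section_of_union hf isOpen_compl_singleton
    isOpen_compl_singleton hcover (isConnected_sphere_compl_pair_neg hV v).isPreconnected hs ht hfs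
    hft hx₀ htx₀.symm
  have : Nonempty (sphere (0 : V) 1) := ⟨x₀⟩
  exact bijective_of_continuous_section hf hg hfg

end Covering

section Circle

/-- The arc length parametrization of the unit circle. -/
noncomputable def circleParam (t : ℝ) : sphere (0 : EuclideanSpace ℝ (Fin (1 + 1))) 1 :=
  ⟨!₂[Real.cos t, Real.sin t], by
    rw [mem_sphere_zero_iff_norm, EuclideanSpace.norm_eq, Fin.sum_univ_two, Real.sqrt_eq_one]
    simp⟩

theorem contMDiff_circleParam : ContMDiff 𝓘(ℝ, ℝ) (𝓡 1) ∞ circleParam := by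
  have := Fact.mk (@finrank_euclideanSpace_fin ℝ _ (1 + 1))
  refine ContMDiff.codRestrict_sphere (contDiff_euclidean.2 fun i => ?_).contMDiff _
  fin_cases i
  · exact Real.contDiff_cos
  · exact Real.contDiff_sin

theorem hasDerivAt_coe_circleParam (t : ℝ) :
    HasDerivAt (fun s => (circleParam s : EuclideanSpace ℝ (Fin (1 + 1))))
      (circleParam (t + Real.pi / 2)) t := by
  refine HasStrictDerivAt.hasDerivAt (hasStrictFDerivAt_euclidean.2 fun i => ?_)
  fin_cases i
  · refine (Real.hasStrictDerivAt_cos t).hasStrictFDerivAt.congr_fderiv ?_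
    ext
    simp [circleParam, Real.cos_add_pi_div_two]
  · refine (Real.hasStrictDerivAt_sin t).hasStrictFDerivAt.congr_fderiv ?_
    ext
    simp [circleParam, Real.sin_add_pi_div_two]

theorem circleParam_eq_iff {s t : ℝ} :
    circleParam s = circleParam t ↔ s - t ∈ AddSubgroup.zmultiples (2 * Real.pi) := by
  have hangle : (s : Real.Angle) = t ↔ s - t ∈ AddSubgroup.zmultiples (2 * Real.pi) := by
    rw [Real.Angle.angle_eq_iff_two_pi_dvd_sub, AddSubgroup.mem_zmultiples_iff]
    simp only [zsmul_eq_mul, mul_comm, eq_comm]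
  rw [← hangle]
  refine ⟨fun h => ?_, fun h => Subtype.ext ?_⟩
  · have hcoord (i : Fin (1 + 1)) :=
      congrArg (fun y : sphere _ _ => (y : EuclideanSpace ℝ (Fin (1 + 1))) i) h
    exact Real.Angle.cos_sin_inj (hcoord 0) (hcoord 1)
  · have hcos : Real.cos s = Real.cos t := congrArg Real.Angle.cos h
    have hsin : Real.sin s = Real.sin t := congrArg Real.Angle.sin h
    simp only [circleParam, hcos, hsin]

theorem isLocalDiffeomorph_circleParam : IsLocalDiffeomorph 𝓘(ℝ, ℝ) (𝓡 1) ∞ circleParam := by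
  have := Fact.mk (@finrank_euclideanSpace_fin ℝ _ (1 + 1))
  intro t
  set ι : sphere (0 : EuclideanSpace ℝ (Fin (1 + 1))) 1 → EuclideanSpace ℝ (Fin (1 + 1)) :=
    Subtype.val
  have hι : ContMDiff (𝓡 1) 𝓘(ℝ, EuclideanSpace ℝ (Fin (1 + 1))) ∞ ι := contMDiff_coe_sphere
  have hcomp (a : ℝ) : mvfderiv (𝓡 1) ι (circleParam t)
      (mfderiv 𝓘(ℝ, ℝ) (𝓡 1) circleParam t a) = a • ι (circleParam (t + Real.pi / 2)) :=
    (mfderiv_comp_apply t (hι.mdifferentiableAt (by simp))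
      (contMDiff_circleParam.mdifferentiableAt (by simp)) a).symm.trans
      (DFunLike.congr_fun (hasDerivAt_coe_circleParam t).hasFDerivAt.hasMFDerivAt.mfderiv a)
  refine isLocalDiffeomorphAt_of_injective_mfderiv (by simp) contMDiff_circleParam (by simp)
    fun a b hab => ?_
  have hne : ι (circleParam (t + Real.pi / 2)) ≠ 0 := ne_zero_of_mem_unit_sphere _
  exact smul_left_injective ℝ hne
    ((hcomp a).symm.trans ((congrArg (mvfderiv (𝓡 1) ι (circleParam t)) hab).trans (hcomp b)))

theorem surjective_of_periodic_of_isOpenMap {Z : Type*} [TopologicalSpace Z] [T2Space Z]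
    [PreconnectedSpace Z] {γ : ℝ → Z} (hγ : Continuous γ) (hopen : IsOpenMap γ) {T : ℝ}
    (hT : T ≠ 0) (hper : Periodic γ T) : Surjective γ := by
  have hclosed : IsClosed (range γ) := by
    rw [← hper.image_uIcc hT 0]
    exact (isCompact_uIcc.image hγ).isClosed
  exact range_eq_univ.1 (IsClopen.eq_univ ⟨hclosed, hopen.isOpen_range⟩ (range_nonempty γ))

theorem surjective_circleParam : Surjective circleParam := by
  have hrank : 1 < Module.rank ℝ (EuclideanSpace ℝ (Fin (1 + 1))) :=
    Module.lt_rank_of_lt_finrank (by simp)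
  have := isPreconnected_iff_preconnectedSpace.1
    (isPreconnected_sphere hrank (0 : EuclideanSpace ℝ (Fin (1 + 1))) 1)
  exact surjective_of_periodic_of_isOpenMap contMDiff_circleParam.continuous
    isLocalDiffeomorph_circleParam.isOpenMap Real.two_pi_pos.ne' fun t =>
      circleParam_eq_iff.2 (by simp)

section Period

variable {E B : Type*} [TopologicalSpace E] [TopologicalSpace B] {f : E → B} {γ : ℝ → E} {T : ℝ}

theorem periodic_of_isCoveringMap (hf : IsCoveringMap f) (hγ : Continuous γ)
    (hfγ : ∀ s t, f (γ s) = f (γ t) ↔ s - t ∈ AddSubgroup.zmultiples T) {s t : ℝ}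
    (hst : γ s = γ t) : Periodic γ (s - t) := by
  have hmem : s - t ∈ AddSubgroup.zmultiples T := (hfγ s t).1 (congrArg f hst)
  exact congrFun (hf.eq_of_comp_eq (g₁ := fun u => γ (u + (s - t))) (g₂ := γ) (by fun_prop) hγ
    (funext fun u => (hfγ _ _).2 (by simpa using hmem)) t (by simpa using hst))

theorem exists_periodic_of_isCoveringMap [CompactSpace E] [T1Space B] (hf : IsCoveringMap f)
    (hγ : Continuous γ) (hT : T ≠ 0)
    (hfγ : ∀ s t, f (γ s) = f (γ t) ↔ s - t ∈ AddSubgroup.zmultiples T) :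
    ∃ c ≠ 0, Periodic γ c := by
  have hfib : Finite (f ⁻¹' {f (γ 0)}) := by
    have : DiscreteTopology (f ⁻¹' {f (γ 0)}) := (hf _).discreteTopology_fiber
    exact ((isClosed_singleton.preimage hf.continuous).isCompact.finite ⟨this⟩).to_subtype
  obtain ⟨i, j, hij, h⟩ := Finite.exists_ne_map_eq_of_infinite fun i : ℕ =>
    (⟨γ (i • T), (hfγ _ _).2 ⟨i, by simp⟩⟩ : f ⁻¹' {f (γ 0)})
  refine ⟨i • T - j • T, ?_, periodic_of_isCoveringMap hf hγ hfγ (congrArg Subtype.val h)⟩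
  simpa [sub_eq_zero, hT] using hij

theorem exists_eq_iff_mem_zmultiples_of_isCoveringMap [CompactSpace E] [T1Space B]
    (hf : IsCoveringMap f) (hγ : Continuous γ) (hT : 0 < T)
    (hfγ : ∀ s t, f (γ s) = f (γ t) ↔ s - t ∈ AddSubgroup.zmultiples T) :
    ∃ S ≠ 0, ∀ s t, γ s = γ t ↔ s - t ∈ AddSubgroup.zmultiples S := by
  set H : AddSubgroup ℝ :=
    { carrier := {c | Periodic γ c}
      zero_mem' := fun t => by rw [add_zero]
      add_mem' := Periodic.add_period
      neg_mem' := Periodic.neg }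
  have hH (s t : ℝ) : γ s = γ t ↔ s - t ∈ H :=
    ⟨periodic_of_isCoveringMap hf hγ hfγ, fun h => by simpa using h t⟩
  have hisolated : Disjoint (H : Set ℝ) (Ioo 0 T) := by
    refine disjoint_left.2 fun c hc hcT => ?_
    obtain ⟨m, hm⟩ := (hfγ c 0).1 (congrArg f ((hH c 0).2 (by simpa using hc)))
    obtain rfl : m • T = c := by simpa using hm
    have hmono : StrictMono fun m : ℤ => m • T := zsmul_left_strictMono hT
    have h0 : 0 < m := hmono.lt_iff_lt.1 (by simpa using hcT.1)
    have h1 : m < 1 := hmono.lt_iff_lt.1 (by simpa using hcT.2)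
    omega
  obtain ⟨S, hS⟩ := AddSubgroup.cyclic_of_isolated_zero hT hisolated
  rw [← AddSubgroup.zmultiples_eq_closure] at hS
  refine ⟨S, ?_, hS ▸ hH⟩
  rintro rfl
  obtain ⟨c, hc, hper⟩ := exists_periodic_of_isCoveringMap hf hγ hT.ne' hfγ
  have : c ∈ H := hper
  exact hc (by simpa [hS] using this)

end Period

variable {M : Type*} [TopologicalSpace M] [ChartedSpace (EuclideanSpace ℝ (Fin 1)) M]

theorem exists_isLocalDiffeomorph_lift_circleParam [Nonempty M]
    {Y : M → sphere (0 : EuclideanSpace ℝ (Fin (1 + 1))) 1}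
    (hY : IsLocalDiffeomorph (𝓡 1) (𝓡 1) ∞ Y) (hcov : IsCoveringMap Y) :
    ∃ γ : ℝ → M, IsLocalDiffeomorph 𝓘(ℝ, ℝ) (𝓡 1) ∞ γ ∧ Y ∘ γ = circleParam := by
  obtain ⟨p⟩ := ‹Nonempty M›
  obtain ⟨t, ht⟩ := surjective_circleParam (Y p)
  obtain ⟨γ, ⟨-, hγ⟩, -⟩ := hcov.existsUnique_continuousMap_lifts
    ⟨circleParam, contMDiff_circleParam.continuous⟩ t p ht.symm
  exact ⟨γ, fun s => isLocalDiffeomorphAt_of_comp_left γ.continuous.continuousAt (hY _)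
    (hγ ▸ isLocalDiffeomorph_circleParam s), hγ⟩

theorem exists_bijective_comp_eq_circleParam {γ : ℝ → M}
    (hγ : IsLocalDiffeomorph 𝓘(ℝ, ℝ) (𝓡 1) ∞ γ) (hsurj : Surjective γ) {T : ℝ} (hT : T ≠ 0)
    (heq : ∀ s t, γ s = γ t ↔ s - t ∈ AddSubgroup.zmultiples T) :
    ∃ Φ : M → sphere (0 : EuclideanSpace ℝ (Fin (1 + 1))) 1,
      IsLocalDiffeomorph (𝓡 1) (𝓡 1) ∞ Φ ∧ Bijective Φ ∧
        ∀ t, Φ (γ t) = circleParam (2 * Real.pi / T * t) := by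
  set c := 2 * Real.pi / T
  have hc : c ≠ 0 := div_ne_zero Real.two_pi_pos.ne' hT
  have hiff (s t : ℝ) : circleParam (c * s) = circleParam (c * t) ↔ γ s = γ t := by
    have hcT : 2 * Real.pi = c * T := (div_mul_cancel₀ _ hT).symm
    rw [circleParam_eq_iff, heq, AddSubgroup.mem_zmultiples_iff, AddSubgroup.mem_zmultiples_iff]
    simp only [← mul_sub, hcT, ← mul_smul_comm, mul_right_inj' hc]
  obtain ⟨σ, hσ⟩ := hsurj.hasRightInverse
  have hΦγ (t : ℝ) : circleParam (c * σ (γ t)) = circleParam (c * t) := (hiff _ _).2 (hσ (γ t))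
  refine ⟨fun p => circleParam (c * σ p), fun p => ?_, ⟨fun p q hpq => ?_, fun y => ?_⟩, hΦγ⟩
  · obtain ⟨t, rfl⟩ := hsurj p
    refine isLocalDiffeomorphAt_of_comp_right (hγ t) (isLocalDiffeomorphAt_congr ?_
      (Eventually.of_forall hΦγ))
    have hmul : IsLocalDiffeomorphAt 𝓘(ℝ, ℝ) 𝓘(ℝ, ℝ) ∞ (fun t => c * t) t :=
      (ContinuousLinearEquiv.smulLeft (Units.mk0 c hc)).toDiffeomorph.isLocalDiffeomorph t
    exact hmul.comp 𝓘(ℝ, EuclideanSpace ℝ (Fin 1)) _ (isLocalDiffeomorph_circleParam (c * t))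
  · rw [← hσ p, ← hσ q]
    exact (hiff _ _).1 hpq
  · obtain ⟨t, rfl⟩ := surjective_circleParam y
    exact ⟨γ (c⁻¹ * t), by simp only [hΦγ, mul_inv_cancel_left₀ hc]⟩

theorem firstFundamentalForm_mfderiv_of_hasDerivAt {n m : ℕ} {M : Type*} [TopologicalSpace M]
    [ChartedSpace (EuclideanSpace ℝ (Fin n)) M] {X : M → EuclideanSpace ℝ (Fin m)} {γ : ℝ → M}
    {t : ℝ} {c : EuclideanSpace ℝ (Fin m)}
    (hX : MDifferentiableAt (𝓡 n) 𝓘(ℝ, EuclideanSpace ℝ (Fin m)) X (γ t))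
    (hγ : MDifferentiableAt 𝓘(ℝ, ℝ) (𝓡 n) γ t) (h : HasDerivAt (X ∘ γ) c t) (a b : ℝ) :
    firstFundamentalForm (n := n) X (γ t) (mfderiv 𝓘(ℝ, ℝ) (𝓡 n) γ t a)
      (mfderiv 𝓘(ℝ, ℝ) (𝓡 n) γ t b) = a * b * ‖c‖ ^ 2 := by
  have hcomp (u : ℝ) : mvfderiv (𝓡 n) X (γ t) (mfderiv 𝓘(ℝ, ℝ) (𝓡 n) γ t u) = u • c :=
    (mfderiv_comp_apply t hX hγ u).symm.trans
      (DFunLike.congr_fun h.hasFDerivAt.hasMFDerivAt.mfderiv u)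
  rw [firstFundamentalForm, hcomp, hcomp, real_inner_smul_left, real_inner_smul_right,
    real_inner_self_eq_norm_sq, mul_assoc]

theorem firstFundamentalForm_mfderiv_of_comp_eq_smul_circleParam
    {X : M → EuclideanSpace ℝ (Fin (1 + 1))} {γ : ℝ → M} {t r c : ℝ}
    (hX : MDifferentiableAt (𝓡 1) 𝓘(ℝ, EuclideanSpace ℝ (Fin (1 + 1))) X (γ t))
    (hγ : MDifferentiableAt 𝓘(ℝ, ℝ) (𝓡 1) γ t)
    (h : ∀ s, X (γ s) = r • (circleParam (c * s) : EuclideanSpace ℝ (Fin (1 + 1)))) (a b : ℝ) :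
    firstFundamentalForm (n := 1) X (γ t) (mfderiv 𝓘(ℝ, ℝ) (𝓡 1) γ t a)
      (mfderiv 𝓘(ℝ, ℝ) (𝓡 1) γ t b) = a * b * (r * c) ^ 2 := by
  have hderiv : HasDerivAt (X ∘ γ) ((r * c) • (circleParam (c * t + Real.pi / 2) :
      EuclideanSpace ℝ (Fin (1 + 1)))) t := by
    rw [show X ∘ γ = _ from funext h, mul_smul]
    refine (((hasDerivAt_coe_circleParam (c * t)).scomp t
      ((hasDerivAt_id t).const_mul c)).const_smul r).congr_deriv ?_
    rw [mul_one]
  rw [firstFundamentalForm_mfderiv_of_hasDerivAt hX hγ hderiv, norm_smul, norm_eq_of_mem_sphere,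
    mul_one, Real.norm_eq_abs, sq_abs]

theorem exists_isIsometricToSphere_of_isLocalDiffeomorph_circle [T2Space M] [CompactSpace M]
    [ConnectedSpace M] {Y : M → sphere (0 : EuclideanSpace ℝ (Fin (1 + 1))) 1}
    (hY : IsLocalDiffeomorph (𝓡 1) (𝓡 1) ∞ Y) {ρ : ℝ} (hρ : 0 < ρ) :
    ∃ r : ℝ, 0 < r ∧
      IsIsometricToSphere (fun p => ρ • (Y p : EuclideanSpace ℝ (Fin (1 + 1)))) r := by
  have hcov : IsCoveringMap Y := isLocalHomeomorph_iff_isCoveringMap.1 hY.isLocalHomeomorph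
  obtain ⟨γ, hγ, hYγ⟩ := exists_isLocalDiffeomorph_lift_circleParam hY hcov
  have hYγ' (t : ℝ) : Y (γ t) = circleParam t := congrFun hYγ t
  obtain ⟨T, hT, heq⟩ := exists_eq_iff_mem_zmultiples_of_isCoveringMap hcov hγ.contMDiff.continuous
    Real.two_pi_pos fun s t => by rw [hYγ', hYγ', circleParam_eq_iff]
  have hsurj : Surjective γ := surjective_of_periodic_of_isOpenMap hγ.contMDiff.continuous
    hγ.isOpenMap hT fun t => (heq _ _).2 (by simp)
  obtain ⟨Φ, hΦ, hbij, hΦγ⟩ := exists_bijective_comp_eq_circleParam hγ hsurj hT heq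
  refine ⟨ρ * (|T| / (2 * Real.pi)), by positivity,
    isIsometricToSphere_of_isLocalDiffeomorph hΦ hbij fun p v w => ?_⟩
  have hsmul {Z : M → sphere (0 : EuclideanSpace ℝ (Fin (1 + 1))) 1} (r : ℝ)
      (hZ : IsLocalDiffeomorph (𝓡 1) (𝓡 1) ∞ Z) (p : M) :
      MDifferentiableAt (𝓡 1) 𝓘(ℝ, EuclideanSpace ℝ (Fin (1 + 1)))
        (fun q => r • (Z q : EuclideanSpace ℝ (Fin (1 + 1)))) p :=
    ((contMDiff_smul_coe_sphere r).comp hZ.contMDiff).mdifferentiableAt (by simp)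
  obtain ⟨t, rfl⟩ := hsurj p
  have hdγ : Surjective (mfderiv 𝓘(ℝ, ℝ) (𝓡 1) γ t) :=
    ((hγ t).mfderivToContinuousLinearEquiv (by simp)).surjective
  obtain ⟨a, rfl⟩ := hdγ v
  obtain ⟨b, rfl⟩ := hdγ w
  have hγt := hγ.contMDiff.mdifferentiableAt (by simp) (x := t)
  refine (firstFundamentalForm_mfderiv_of_comp_eq_smul_circleParam (hsmul _ hΦ _) hγt
    (fun s => by rw [hΦγ]) a b).trans (.trans ?_
    (firstFundamentalForm_mfderiv_of_comp_eq_smul_circleParam (c := 1) (hsmul _ hY _) hγt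
      (fun s => by rw [hYγ', one_mul]) a b).symm)
  field_simp
  rw [sq_abs]

end Circle

theorem IsLambdaHypersurface.exists_isIsometricToSphere {n : ℕ} (hn : 1 ≤ n) {M : Type*}
    [TopologicalSpace M] [ChartedSpace (EuclideanSpace ℝ (Fin n)) M] [IsManifold (𝓡 n) ∞ M]
    [T2Space M] [CompactSpace M] [ConnectedSpace M]
    {X N : M → EuclideanSpace ℝ (Fin (n + 1))} {l ρ : ℝ} (hX : IsLambdaHypersurface X N l)
    (hρ : ∀ p, ‖X p‖ = ρ) : ∃ r : ℝ, 0 < r ∧ IsIsometricToSphere X r := by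
  obtain ⟨Y, hY, rfl⟩ := exists_isLocalDiffeomorph_sphere hX.smooth hX.immersion
    (hX.pos_of_norm_eq hn hρ) hρ
  obtain rfl | hn2 := hn.eq_or_lt
  · exact exists_isIsometricToSphere_of_isLocalDiffeomorph_circle hY (hX.pos_of_norm_eq hn hρ)
  · have hcov : IsCoveringMap Y := isLocalHomeomorph_iff_isCoveringMap.1 hY.isLocalHomeomorph
    have hdim : 2 < Module.finrank ℝ (EuclideanSpace ℝ (Fin (n + 1))) := by
      rw [finrank_euclideanSpace_fin]
      omega
    exact ⟨ρ, hX.pos_of_norm_eq hn hρ, isIsometricToSphere_of_isLocalDiffeomorph hY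
      (bijective_of_isCoveringMap_sphere hdim hcov) fun _ _ _ => rfl⟩

end LambdaHypersurface

theorem proposition1p1 {n : ℕ} (hn : 1 ≤ n) {M : Type*} [TopologicalSpace M]
    [ChartedSpace (EuclideanSpace ℝ (Fin n)) M] [IsManifold (𝓡 n) ∞ M]
    [T2Space M] [CompactSpace M] [ConnectedSpace M]
    (X N : M → EuclideanSpace ℝ (Fin (n + 1))) (l : ℝ)
    (hX : LambdaHypersurface.IsLambdaHypersurface X N l)
    (hH : ∀ p : M,
      (LambdaHypersurface.meanCurvature (n := n) X (N p) p - l / 2) ^ 2 ≤ n + l ^ 2 / 4) :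
    (∀ p : M, (LambdaHypersurface.meanCurvature (n := n) X (N p) p - l / 2) ^ 2 = n + l ^ 2 / 4) ∧
      ∃ r : ℝ, 0 < r ∧ LambdaHypersurface.IsIsometricToSphere X r := by
  obtain ⟨ρ, hρ⟩ := hX.exists_norm_eq hH
  exact ⟨hX.sq_eq_of_norm_eq hρ, hX.exists_isIsometricToSphere hn hρ⟩
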